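/- **Setting.** Let $G$ be a discrete group. A *quadratik $G$-ring* is an associative, not necessarily unital or commutative ring $A$ with an action of $G$ by ring automorphisms such that every element of $A$ is a finite sum of products $ab$, $a,b\in A$. A *right functional $A$-module* is a right $A$-module $\mathcal E$ with an action of $G$ by additive maps satisfying $g(\xi a)=g(\xi)g(a)$, together with a $G$-invariant left $A$-submodule $\Theta_A(\mathcal E)\subseteq \mathrm{Hom}_A(\mathcal E,A)$ of functionals; $\mathcal K_A(\mathcal E)$ is the ring of finite sums of operators $\theta_{\eta,\phi}(\xi)=\eta\,\phi(\xi)$, $\eta\in\mathcal E$, $\phi\in\Theta_A(\mathcal E)$, with the conjugation action, and $\mathcal E$ is *cofull* if every element is a finite sum of elements $\eta\,\phi(\zeta)$. The ring $A$ is a functional module over itself with $\Theta_A(A)=A$ acting by left multiplication; direct sums have the functionals $\bigoplus_i\phi_i$. A *corner embedding* is a homomorphism $e:A\to\mathcal K_A(\mathcal E\oplus\mathcal H_A)$, $e(a)(\xi\oplus b\oplus\eta)=0\oplus ab\oplus 0$, where $\mathcal E$ is a functional $A$-module, $\mathcal H_A=A\oplus\bigoplus_{J}A$ for a (possibly empty)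 set $J$, with the given action on the first summand and any compatible action on the functional module $\bigoplus_J A$, and $\mathcal E\oplus\mathcal H_A$ is cofull. Homomorphisms $f_0,f_1:A\to B$ are *homotopic* if there is a $G$-equivariant ring homomorphism $F:A\to B\otimes_{\mathbb Z} C([0,1],\mathbb C)$ ($G$ acting trivially on the second factor) whose evaluations at $t=0,1$ in $B\otimes_{\mathbb Z}\mathbb C$ are $f_t\otimes 1$. The category $GK^G$ has as objects all quadratik $G$-rings (in a fixed universe). It is the preadditive category generated by the $G$-equivariant ring homomorphisms, a morphism $e^{-1}:\mathcal K_A(\mathcal E\oplus\mathcal H_A)\to A$ for every corner embedding $e$, and a morphism $\Delta_s:M\to B$ for every split exact sequence $0\to B\xrightarrow{j}M\xrightarrow{f}A\to0$ with equivariant splitting $s$, subject to the relations (compositions written from left to right): composites and identities of ring homomorphisms are composites and identities in $GK^G$; $1_{A\oplus B}=p_Ai_A+p_Bi_B$ for the projections and injections of direct sums; homotopic homomorphisms are equal; $e^{-1}$ is inverse to $e$; $j\Delta_s=1_B$ and $1_M=\Delta_s j+fs$. Let $H\subseteq G$ be a subgroup. For a quadratik $H$-ring $A$ let $\mathrm{Ind}_H^G(A)$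 be the ring, under pointwise operations, of all functions $f:G\to A$ with $f(gh)=h^{-1}(f(g))$ for all $g\in G$, $h\in H$ which vanish on all but finitely many cosets $gH$, with the $G$-action $(kf)(x)=f(k^{-1}x)$. The *induction functor* $\mathrm{Ind}_H^G:GK^H\to GK^G$ is the additive functor given on objects by this construction, on ring homomorphisms by $f\mapsto\pi\circ f$, and otherwise by $\mathrm{Ind}_H^G(e^{-1})=(\mathrm{Ind}_H^G(e))^{-1}$ and $\mathrm{Ind}_H^G(\Delta_s)=\Delta_{\mathrm{Ind}_H^G(s)}$. The *restriction functor* $\mathrm{Res}_G^H:GK^G\to GK^H$ is the additive functor which restricts the actions on rings and the equivariance of homomorphisms from $G$ to $H$, with $\mathrm{Res}_G^H(e^{-1})=(\mathrm{Res}_G^H(e))^{-1}$ and $\mathrm{Res}_G^H(\Delta_s)=\Delta_{\mathrm{Res}_G^H(s)}$. **Proposition.** For every discrete group $G$ and every subgroup $H\subseteq G$, the functor $\mathrm{Ind}_H^G:GK^H\to GK^G$ is left adjoint to $\mathrm{Res}_G^H:GK^G\to GK^H$: there are isomorphisms of abelian groups $$GK^G\big(\mathrm{Ind}_H^G(A),B\big)\;\cong\;GK^H\big(A,\mathrm{Res}_G^H(B)\big),$$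 natural in $A\in GK^H$ and $B\in GK^G$. -/

import Mathlib

open CategoryTheory TensorProduct

namespace GKTheory

universe u

noncomputable section

/-! ### Equivariant quadratik rings -/

/-- A quadratik `G`-ring: an associative, not necessarily unital or commutative ring with an action
of the discrete group `G` by ring automorphisms, such that every element is a finite sum of
products. -/
structure GRing (G : Type u) [Group G] where
  carrier : Type u
  [ring : NonUnitalRing carrier]
  [action : DistribMulAction G carrier]
  smul_mul : ∀ (g : G) (a b : carrier), g • (a * b) = g • a * g • b
  quadratik : ∀ a : carrier, a ∈ AddSubgroup.closure {x : carrier | ∃ b c, x = b * c}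

attribute [instance] GRing.ring GRing.action

instance {G : Type u} [Group G] : CoeSort (GRing G) (Type u) := ⟨GRing.carrier⟩

/-- `G`-equivariant ring homomorphisms. -/
@[ext]
structure RHom {G : Type u} [Group G] (A B : GRing G) where
  toHom : A →ₙ+* B
  map_smul : ∀ (g : G) (a : A), toHom (g • a) = g • toHom a

namespace RHom

variable {G : Type u} [Group G] {A B C : GRing G}

instance : CoeFun (RHom A B) (fun _ => A → B) := ⟨fun f => f.toHom⟩

/-- The identity homomorphism. -/
def id (A : GRing G) : RHom A A := ⟨NonUnitalRingHom.id A, fun _ _ => rfl⟩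

/-- Composition, written from left to right. -/
def comp (f : RHom A B) (g : RHom B C) : RHom A C :=
  ⟨g.toHom.comp f.toHom, fun k a => by simp [f.map_smul, g.map_smul]⟩

@[simp] theorem id_apply (a : A) : RHom.id A a = a := rfl

@[simp] theorem comp_apply (f : RHom A B) (g : RHom B C) (a : A) : f.comp g a = g (f a) := rfl

theorem ext_apply {f g : RHom A B} (h : ∀ a, f a = g a) : f = g :=
  RHom.ext (NonUnitalRingHom.ext h)

end RHom

section Basic

variable {G : Type u} [Group G]

/-- The direct sum `A ⊕ B` of two `G`-rings. -/
def GRing.prod (A B : GRing G) : GRing G where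
  carrier := A × B
  smul_mul g a b := Prod.ext (A.smul_mul g _ _) (B.smul_mul g _ _)
  quadratik := by
    have hA : ∀ a : A, ((a, 0) : A × B) ∈
        AddSubgroup.closure {x : A × B | ∃ b c, x = b * c} := by
      intro a
      induction A.quadratik a using AddSubgroup.closure_induction with
      | mem x hx =>
        obtain ⟨b, c, rfl⟩ := hx
        exact AddSubgroup.subset_closure ⟨(b, 0), (c, 0), by simp⟩
      | zero => exact zero_mem _
      | add x y _ _ hx hy => simpa using add_mem hx hy
      | neg x _ hx => simpa using neg_mem hx
    have hB : ∀ b : B, ((0, b) : A × B) ∈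
        AddSubgroup.closure {x : A × B | ∃ b c, x = b * c} := by
      intro a
      induction B.quadratik a using AddSubgroup.closure_induction with
      | mem x hx =>
        obtain ⟨b, c, rfl⟩ := hx
        exact AddSubgroup.subset_closure ⟨(0, b), (0, c), by simp⟩
      | zero => exact zero_mem _
      | add x y _ _ hx hy => simpa using add_mem hx hy
      | neg x _ hx => simpa using neg_mem hx
    rintro ⟨a, b⟩
    simpa using add_mem (hA a) (hB b)

/-- The canonical projection `A ⊕ B → A`. -/
def projLeft (A B : GRing G) : RHom (A.prod B) A := ⟨NonUnitalRingHom.fst A B, fun _ _ => rfl⟩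

/-- The canonical projection `A ⊕ B → B`. -/
def projRight (A B : GRing G) : RHom (A.prod B) B := ⟨NonUnitalRingHom.snd A B, fun _ _ => rfl⟩

/-- The canonical injection `A → A ⊕ B`. -/
def inLeft (A B : GRing G) : RHom A (A.prod B) where
  toHom :=
    { toFun := fun a => ((a, 0) : A × B)
      map_zero' := rfl
      map_add' := fun _ _ => Prod.ext rfl (add_zero _).symm
      map_mul' := fun _ _ => Prod.ext rfl (mul_zero _).symm }
  map_smul _ _ := Prod.ext rfl (smul_zero _).symm

/-- The canonical injection `B → A ⊕ B`. -/
def inRight (A B : GRing G) : RHom B (A.prod B) where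
  toHom :=
    { toFun := fun b => ((0, b) : A × B)
      map_zero' := rfl
      map_add' := fun _ _ => Prod.ext (add_zero _).symm rfl
      map_mul' := fun _ _ => Prod.ext (mul_zero _).symm rfl }
  map_smul _ _ := Prod.ext (smul_zero _).symm rfl

/-- Evaluation at `t ∈ [0,1]` of continuous complex functions. -/
def evalAt (t : unitInterval) : C(unitInterval, ℂ) →ₗ[ℤ] ℂ where
  toFun z := z t
  map_add' _ _ := rfl
  map_smul' _ _ := rfl

/-- Two homomorphisms `f₀, f₁ : A → B` are the endpoints of a homotopy: there is a `G`-equivariant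
ring homomorphism `F : A → B[0,1] = B ⊗ C([0,1], ℂ)` (`G` acting trivially on the second factor)
whose evaluations `A → B ⊗ ℂ` at `0` and `1` are `f₀ ⊗ 1` and `f₁ ⊗ 1`. -/
def Homotopic {A B : GRing G} (f₀ f₁ : RHom A B) : Prop :=
  ∃ F : A →ₙ+* (B ⊗[ℤ] C(unitInterval, ℂ)),
    (∀ (g : G) (a : A),
      F (g • a) =
        LinearMap.rTensor C(unitInterval, ℂ)
          (DistribSMul.toAddMonoidHom B g).toIntLinearMap (F a)) ∧
    (∀ a : A, LinearMap.lTensor B (evalAt 0) (F a) = f₀ a ⊗ₜ[ℤ] (1 : ℂ)) ∧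
    (∀ a : A, LinearMap.lTensor B (evalAt 1) (F a) = f₁ a ⊗ₜ[ℤ] (1 : ℂ))

/-- A split short exact sequence `0 ⟶ B ⟶ M ⟶ A ⟶ 0` of `G`-rings, with maps `j`, `f` and
splitting `s`; surjectivity of `f` follows from `split`. -/
structure SplitExact (B M A : GRing G) where
  j : RHom B M
  f : RHom M A
  s : RHom A M
  injective : Function.Injective j
  exact : ∀ m : M, f m = 0 ↔ ∃ b : B, j b = m
  split : ∀ a : A, f (s a) = a

end Basic

/-! ### Functional modules and corner embeddings -/

/-- A right functional `A`-module: a right `A`-module with a compatible `G`-action and a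
distinguished functional space `Θ`, which is a `G`-invariant left `A`-submodule of
`Hom_A(E, A)`. -/
structure FMod {G : Type u} [Group G] (A : GRing G) where
  carrier : Type u
  [group : AddCommGroup carrier]
  [action : DistribMulAction G carrier]
  /-- The right multiplication `ξ ↦ a ↦ ξ a`. -/
  rsmul : carrier →+ A →+ carrier
  rsmul_mul : ∀ ξ a b, rsmul ξ (a * b) = rsmul (rsmul ξ a) b
  smul_rsmul : ∀ (g : G) ξ a, g • rsmul ξ a = rsmul (g • ξ) (g • a)
  /-- The functional space `Θ`. -/
  functionals : AddSubgroup (carrier →+ A)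
  map_rsmul : ∀ φ ∈ functionals, ∀ ξ a, φ (rsmul ξ a) = φ ξ * a
  mul_mem : ∀ (a : A), ∀ φ ∈ functionals, (AddMonoidHom.mulLeft a).comp φ ∈ functionals
  conj_mem : ∀ (g : G), ∀ φ ∈ functionals,
    (DistribSMul.toAddMonoidHom A g).comp
      (φ.comp (DistribSMul.toAddMonoidHom carrier g⁻¹)) ∈ functionals

attribute [instance] FMod.group FMod.action

instance {G : Type u} [Group G] {A : GRing G} : CoeSort (FMod A) (Type u) := ⟨FMod.carrier⟩

namespace FMod

variable {G : Type u} [Group G] {A : GRing G}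

/-- The functional space as a type, with the `G`-action `(gφ)(ξ) = g φ(g⁻¹ ξ)`. -/
def Dual (E : FMod A) : Type u := E.functionals

instance (E : FMod A) : AddCommGroup E.Dual := inferInstanceAs (AddCommGroup E.functionals)

instance (E : FMod A) : DistribMulAction G E.Dual where
  smul g φ := ⟨_, E.conj_mem g φ.1 φ.2⟩
  one_smul φ := Subtype.ext <| AddMonoidHom.ext fun ξ => by
    change (1 : G) • φ.1 ((1 : G)⁻¹ • ξ) = φ.1 ξ
    simp
  mul_smul g h φ := Subtype.ext <| AddMonoidHom.ext fun ξ => by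
    change (g * h) • φ.1 ((g * h)⁻¹ • ξ) = g • h • φ.1 (h⁻¹ • g⁻¹ • ξ)
    simp [mul_smul]
  smul_zero g := Subtype.ext <| AddMonoidHom.ext fun _ => smul_zero g
  smul_add g φ ψ := Subtype.ext <| AddMonoidHom.ext fun _ => smul_add g _ _

theorem dual_smul_apply (E : FMod A) (g : G) (φ : E.Dual) (ξ : E) :
    (g • φ).1 ξ = g • φ.1 (g⁻¹ • ξ) := rfl

/-- The elementary operator `θ_{η,φ}(ξ) = η φ(ξ)`. -/
def theta (E : FMod A) (η : E) (φ : E →+ A) : AddMonoid.End E := (E.rsmul η).comp φ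

theorem theta_apply (E : FMod A) (η : E) (φ : E →+ A) (ξ : E) :
    E.theta η φ ξ = E.rsmul η (φ ξ) := rfl

theorem theta_mul (E : FMod A) (η ζ : E) (φ ψ : E →+ A) (hφ : φ ∈ E.functionals) :
    E.theta η φ * E.theta ζ ψ = E.theta (E.rsmul η (φ ζ)) ψ :=
  AddMonoidHom.ext fun ξ => by
    change E.rsmul η (φ (E.rsmul ζ (ψ ξ))) = E.rsmul (E.rsmul η (φ ζ)) (ψ ξ)
    rw [E.map_rsmul φ hφ, E.rsmul_mul]

/-- The set of elementary compact operators. -/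
def elementary (E : FMod A) : Set (AddMonoid.End E) :=
  {T | ∃ (η : E) (φ : E →+ A), φ ∈ E.functionals ∧ T = E.theta η φ}

/-- The ring of compact operators: all finite sums of elementary compact operators. -/
def compacts (E : FMod A) : NonUnitalSubring (AddMonoid.End E) where
  __ := AddSubgroup.closure E.elementary
  mul_mem' := by
    intro S T hS hT
    change S * T ∈ AddSubgroup.closure E.elementary
    induction hS using AddSubgroup.closure_induction with
    | mem S hS =>
      obtain ⟨η, φ, hφ, rfl⟩ := hS
      induction hT using AddSubgroup.closure_induction with
      | mem T hT =>
        obtain ⟨ζ, ψ, hψ, rfl⟩ := hT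
        exact AddSubgroup.subset_closure ⟨_, ψ, hψ, E.theta_mul η ζ φ ψ hφ⟩
      | zero => simp
      | add x y _ _ hx hy => rw [mul_add]; exact add_mem hx hy
      | neg x _ hx => rw [mul_neg]; exact neg_mem hx
    | zero => simp
    | add x y _ _ hx hy => rw [add_mul]; exact add_mem hx hy
    | neg x _ hx => rw [neg_mul]; exact neg_mem hx

theorem mem_compacts {E : FMod A} {T : AddMonoid.End E} :
    T ∈ E.compacts ↔ T ∈ AddSubgroup.closure E.elementary := Iff.rfl

/-- The compact operators as a type, with the `G`-action `gT = g ∘ T ∘ g⁻¹`. -/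
def Compact (E : FMod A) : Type u := E.compacts

instance (E : FMod A) : NonUnitalRing E.Compact := inferInstanceAs (NonUnitalRing E.compacts)

/-- Conjugation of an additive endomorphism by a group element. -/
def conj (E : FMod A) (g : G) : AddMonoid.End E →+ AddMonoid.End E where
  toFun T := (DistribSMul.toAddMonoidHom E g).comp
    (T.comp (DistribSMul.toAddMonoidHom E g⁻¹))
  map_zero' := AddMonoidHom.ext fun _ => smul_zero g
  map_add' _ _ := AddMonoidHom.ext fun _ => smul_add g _ _

theorem conj_apply (E : FMod A) (g : G) (T : AddMonoid.End E) (ξ : E) :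
    E.conj g T ξ = g • T (g⁻¹ • ξ) := rfl

theorem conj_theta (E : FMod A) (g : G) (η : E) (φ : E.Dual) :
    E.conj g (E.theta η φ.1) = E.theta (g • η) (g • φ).1 :=
  AddMonoidHom.ext fun _ => E.smul_rsmul g η _

theorem conj_mem_compacts (E : FMod A) (g : G) {T : AddMonoid.End E} (hT : T ∈ E.compacts) :
    E.conj g T ∈ E.compacts := by
  rw [mem_compacts] at hT ⊢
  induction hT using AddSubgroup.closure_induction with
  | mem T hT =>
    obtain ⟨η, φ, hφ, rfl⟩ := hT
    exact AddSubgroup.subset_closure 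
      ⟨g • η, _, E.conj_mem g φ hφ, E.conj_theta g η ⟨φ, hφ⟩⟩
  | zero => simp
  | add x y _ _ hx hy => rw [map_add]; exact add_mem hx hy
  | neg x _ hx => rw [map_neg]; exact neg_mem hx

instance (E : FMod A) : DistribMulAction G E.Compact where
  smul g T := ⟨E.conj g T.1, E.conj_mem_compacts g T.2⟩
  one_smul T := Subtype.ext <| AddMonoidHom.ext fun ξ => by
    change (1 : G) • T.1 ((1 : G)⁻¹ • ξ) = T.1 ξ
    simp
  mul_smul g h T := Subtype.ext <| AddMonoidHom.ext fun ξ => by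
    change (g * h) • T.1 ((g * h)⁻¹ • ξ) = g • h • T.1 (h⁻¹ • g⁻¹ • ξ)
    simp [mul_smul]
  smul_zero g := Subtype.ext (map_zero (E.conj g))
  smul_add g S T := Subtype.ext (map_add (E.conj g) S.1 T.1)

theorem compact_smul_apply (E : FMod A) (g : G) (T : E.Compact) (ξ : E) :
    (g • T).1 ξ = g • T.1 (g⁻¹ • ξ) := rfl

/-- The elementary compact operator `θ_{η,φ}` as an element of the ring of compact operators. -/
def thetaC (E : FMod A) (η : E) (φ : E.Dual) : E.Compact :=
  ⟨E.theta η φ.1, AddSubgroup.subset_closure ⟨η, φ.1, φ.2, rfl⟩⟩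

theorem compact_induction {E : FMod A} {P : E.Compact → Prop} (h0 : P 0)
    (hadd : ∀ S T, P S → P T → P (S + T)) (hneg : ∀ S, P S → P (-S))
    (hθ : ∀ η φ, P (E.thetaC η φ)) (T : E.Compact) : P T := by
  obtain ⟨T, hT⟩ := T
  refine AddSubgroup.closure_induction (p := fun T hT => P ⟨T, hT⟩) ?_ h0
    (fun x y hx hy ihx ihy => hadd ⟨x, hx⟩ ⟨y, hy⟩ ihx ihy) (fun x hx ihx => hneg ⟨x, hx⟩ ihx) hT
  rintro T ⟨η, φ, hφ, rfl⟩
  exact hθ η ⟨φ, hφ⟩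

/-- A functional module is cofull if every element is a finite sum of elements `η φ(ζ)`. -/
def Cofull (E : FMod A) : Prop :=
  ∀ ξ : E, ξ ∈ AddSubgroup.closure {x : E | ∃ η ζ : E, ∃ φ ∈ E.functionals, x = E.rsmul η (φ ζ)}

/-- The `G`-ring of compact operators on a cofull functional module. -/
def compactRing (E : FMod A) (hE : E.Cofull) : GRing G where
  carrier := E.Compact
  smul_mul g S T := Subtype.ext <| AddMonoidHom.ext fun ξ => by
    change g • S.1 (T.1 (g⁻¹ • ξ)) = g • S.1 (g⁻¹ • g • T.1 (g⁻¹ • ξ))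
    simp
  quadratik := by
    have key : ∀ (φ : E.Dual) (ξ : E), E.thetaC ξ φ ∈
        AddSubgroup.closure {x : E.Compact | ∃ b c, x = b * c} := by
      intro φ ξ
      induction hE ξ using AddSubgroup.closure_induction with
      | mem ξ hξ =>
        obtain ⟨η, ζ, ψ, hψ, rfl⟩ := hξ
        exact AddSubgroup.subset_closure ⟨E.thetaC η ⟨ψ, hψ⟩, E.thetaC ζ φ,
          Subtype.ext (E.theta_mul η ζ ψ φ.1 hψ).symm⟩
      | zero =>
        have : E.thetaC 0 φ = 0 := Subtype.ext <| AddMonoidHom.ext fun x => by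
          change E.rsmul 0 _ = 0
          simp
        rw [this]
        exact zero_mem _
      | add x y _ _ hx hy =>
        have : E.thetaC (x + y) φ = E.thetaC x φ + E.thetaC y φ :=
          Subtype.ext <| AddMonoidHom.ext fun z => by
            change E.rsmul (x + y) _ = E.rsmul x _ + E.rsmul y _
            simp
        rw [this]
        exact add_mem hx hy
      | neg x _ hx =>
        have : E.thetaC (-x) φ = -E.thetaC x φ :=
          Subtype.ext <| AddMonoidHom.ext fun z => by
            change E.rsmul (-x) _ = -E.rsmul x _
            simp
        rw [this]
        exact neg_mem hx
    exact compact_induction (zero_mem _) (fun _ _ => add_mem) (fun _ => neg_mem)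
      (fun η φ => key φ η)

/-- The ring `A` as a right functional module over itself; the functionals are the left
multiplications by elements of `A`. -/
def self (A : GRing G) : FMod A where
  carrier := A
  rsmul := AddMonoidHom.mul
  rsmul_mul ξ a b := (mul_assoc ξ a b).symm
  smul_rsmul := A.smul_mul
  functionals := (AddMonoidHom.mul : A →+ A →+ A).range
  map_rsmul := by
    rintro _ ⟨c, rfl⟩ ξ a
    exact (mul_assoc c ξ a).symm
  mul_mem := by
    rintro a _ ⟨c, rfl⟩
    exact ⟨a * c, AddMonoidHom.ext fun x => mul_assoc a c x⟩
  conj_mem := by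
    rintro g _ ⟨c, rfl⟩
    refine ⟨g • c, AddMonoidHom.ext fun x => ?_⟩
    change (g • c) * x = g • (c * g⁻¹ • x)
    rw [A.smul_mul, smul_inv_smul]

/-- The direct sum of two functional modules, with functionals `φ ⊕ ψ`. -/
def prod (E F : FMod A) : FMod A where
  carrier := E × F
  rsmul := AddMonoidHom.mk' (fun ξ => (E.rsmul ξ.1).prod (F.rsmul ξ.2))
    (fun ξ η => AddMonoidHom.ext fun a => by simp)
  rsmul_mul ξ a b := Prod.ext (E.rsmul_mul _ _ _) (F.rsmul_mul _ _ _)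
  smul_rsmul g ξ a := Prod.ext (E.smul_rsmul _ _ _) (F.smul_rsmul _ _ _)
  functionals :=
    { carrier := {φ | ∃ φ₁ ∈ E.functionals, ∃ φ₂ ∈ F.functionals, φ = φ₁.coprod φ₂}
      zero_mem' := ⟨0, zero_mem _, 0, zero_mem _, AddMonoidHom.ext fun x => by simp⟩
      add_mem' := by
        rintro _ _ ⟨φ₁, h₁, φ₂, h₂, rfl⟩ ⟨ψ₁, k₁, ψ₂, k₂, rfl⟩
        refine ⟨_, add_mem h₁ k₁, _, add_mem h₂ k₂, AddMonoidHom.ext fun x => ?_⟩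
        simp only [AddMonoidHom.add_apply, AddMonoidHom.coprod_apply]
        abel
      neg_mem' := by
        rintro _ ⟨φ₁, h₁, φ₂, h₂, rfl⟩
        refine ⟨_, neg_mem h₁, _, neg_mem h₂, AddMonoidHom.ext fun x => ?_⟩
        simp only [AddMonoidHom.neg_apply, AddMonoidHom.coprod_apply]
        abel }
  map_rsmul := by
    rintro _ ⟨φ₁, h₁, φ₂, h₂, rfl⟩ ξ a
    change φ₁ (E.rsmul ξ.1 a) + φ₂ (F.rsmul ξ.2 a) = (φ₁ ξ.1 + φ₂ ξ.2) * a
    rw [E.map_rsmul φ₁ h₁, F.map_rsmul φ₂ h₂, add_mul]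
  mul_mem := by
    rintro a _ ⟨φ₁, h₁, φ₂, h₂, rfl⟩
    refine ⟨_, E.mul_mem a φ₁ h₁, _, F.mul_mem a φ₂ h₂, AddMonoidHom.ext fun x => ?_⟩
    exact mul_add a _ _
  conj_mem := by
    rintro g _ ⟨φ₁, h₁, φ₂, h₂, rfl⟩
    refine ⟨_, E.conj_mem g φ₁ h₁, _, F.conj_mem g φ₂ h₂, AddMonoidHom.ext fun x => ?_⟩
    exact smul_add g _ _

end FMod

section Corner

variable {G : Type u} [Group G]

/-- Coordinatewise right multiplication on a direct sum of copies of `A`. -/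
def sumRsmul (A : GRing G) (J : Type u) : (J →₀ A) →+ A →+ (J →₀ A) :=
  AddMonoidHom.mk' (fun ξ => AddMonoidHom.mk'
      (fun a => Finsupp.mapRange.addMonoidHom (AddMonoidHom.mulRight a) ξ)
      (fun a b => Finsupp.ext fun j => mul_add (ξ j) a b))
    (fun ξ η => AddMonoidHom.ext fun a => Finsupp.ext fun j => add_mul (ξ j) (η j) a)

/-- The functional `ξ ↦ ∑ j, φ j * ξ j` on a direct sum of copies of `A`. -/
def sumFunctional (A : GRing G) (J : Type u) : (J → A) →+ (J →₀ A) →+ A :=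
  AddMonoidHom.mk' (fun φ => Finsupp.liftAddHom fun j => AddMonoidHom.mulLeft (φ j))
    (fun φ ψ => by ext; simp [add_mul])

theorem sumRsmul_single (A : GRing G) (J : Type u) (j : J) (a b : A) :
    sumRsmul A J (Finsupp.single j a) b = Finsupp.single j (a * b) :=
  Finsupp.mapRange_single (f := fun x => x * b) (hf := zero_mul b)

theorem sumFunctional_single (A : GRing G) (J : Type u) (φ : J → A) (j : J) (a : A) :
    sumFunctional A J φ (Finsupp.single j a) = φ j * a := by
  simp [sumFunctional]

/-- A direct sum of copies of `A` (indexed by a possibly empty set `J`) as a functional module,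
with an arbitrary compatible `G`-action that need not be a direct sum action. -/
structure SumModule (A : GRing G) where
  J : Type u
  act : DistribMulAction G (J →₀ A)
  smul_rsmul : ∀ (g : G) (ξ : J →₀ A) (a : A),
    act.smul g (sumRsmul A J ξ a) = sumRsmul A J (act.smul g ξ) (g • a)
  conj_mem : ∀ (g : G) (φ : J → A), ∃ ψ : J → A, ∀ ξ : J →₀ A,
    sumFunctional A J ψ ξ = g • sumFunctional A J φ (act.smul g⁻¹ ξ)

/-- The functional module underlying a `SumModule`; its functionals are all `⊕ φ_j`. -/
def SumModule.toFMod {A : GRing G} (L : SumModule A) : FMod A where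
  carrier := L.J →₀ A
  action := L.act
  rsmul := sumRsmul A L.J
  rsmul_mul ξ a b := Finsupp.ext fun j => (mul_assoc (ξ j) a b).symm
  smul_rsmul := L.smul_rsmul
  functionals := (sumFunctional A L.J).range
  map_rsmul := by
    rintro _ ⟨φ, rfl⟩ ξ a
    induction ξ using Finsupp.induction_linear with
    | zero => simp
    | add x y hx hy => simp only [map_add, AddMonoidHom.add_apply, add_mul, hx, hy]
    | single j b => rw [sumRsmul_single, sumFunctional_single, sumFunctional_single, mul_assoc]
  mul_mem := by
    rintro a _ ⟨φ, rfl⟩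
    refine ⟨fun j => a * φ j, ?_⟩
    ext j b
    simp [sumFunctional, mul_assoc]
  conj_mem := by
    rintro g _ ⟨φ, rfl⟩
    obtain ⟨ψ, hψ⟩ := L.conj_mem g φ
    exact ⟨ψ, AddMonoidHom.ext hψ⟩

/-- The data of a corner embedding `A → K_A(E ⊕ H_A)`: a functional module `E` and
`H_A = A ⊕ ⨁_J A`, the first summand being the distinguished coordinate, such that `E ⊕ H_A` is
cofull. -/
structure Corner (A : GRing G) where
  E : FMod A
  L : SumModule A
  cofull : (E.prod ((FMod.self A).prod L.toFMod)).Cofull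

namespace Corner

variable {A : GRing G}

/-- The functional module `E ⊕ H_A`. -/
def module (c : Corner A) : FMod A := c.E.prod ((FMod.self A).prod c.L.toFMod)

/-- The ring `K_A(E ⊕ H_A)`. -/
def target (c : Corner A) : GRing G := c.module.compactRing c.cofull

/-- The inclusion `b ↦ 0 ⊕ b ⊕ 0` of the distinguished coordinate. -/
def incl (c : Corner A) : A →+ c.module :=
  (AddMonoidHom.inr c.E (A × (c.L.J →₀ A))).comp (AddMonoidHom.inl A (c.L.J →₀ A))

/-- The projection `ξ ⊕ b ⊕ η ↦ b` onto the distinguished coordinate. -/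
def coord (c : Corner A) : c.module →+ A :=
  (AddMonoidHom.fst A (c.L.J →₀ A)).comp (AddMonoidHom.snd c.E (A × (c.L.J →₀ A)))

theorem coord_incl (c : Corner A) (a : A) : c.coord (c.incl a) = a := rfl

theorem coord_smul (c : Corner A) (g : G) (x : c.module) : c.coord (g • x) = g • c.coord x := rfl

theorem incl_smul (c : Corner A) (g : G) (a : A) : c.incl (g • a) = g • c.incl a :=
  Prod.ext (smul_zero g).symm (Prod.ext rfl (c.L.act.smul_zero g).symm)

theorem incl_mul (c : Corner A) (a b : A) : c.incl (a * b) = c.module.rsmul (c.incl a) b := by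
  refine Prod.ext ?_ (Prod.ext rfl ?_)
  · change 0 = c.E.rsmul 0 b
    simp
  · change 0 = sumRsmul A c.L.J 0 b
    simp

theorem mulLeft_coord_mem (c : Corner A) (a : A) :
    (AddMonoidHom.mulLeft a).comp c.coord ∈ c.module.functionals := by
  refine ⟨0, zero_mem _, (AddMonoidHom.mulLeft a).coprod 0, ⟨_, ⟨a, rfl⟩, 0, zero_mem _, rfl⟩,
    AddMonoidHom.ext fun x => ?_⟩
  change a * c.coord x = 0 + (a * c.coord x + 0)
  rw [add_zero, zero_add]

/-- The operator `ξ ⊕ b ⊕ η ↦ 0 ⊕ a b ⊕ 0`. -/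
def op (c : Corner A) (a : A) : AddMonoid.End c.module :=
  c.incl.comp ((AddMonoidHom.mulLeft a).comp c.coord)

theorem op_apply (c : Corner A) (a : A) (x : c.module) : c.op a x = c.incl (a * c.coord x) := rfl

theorem op_add (c : Corner A) (a b : A) : c.op (a + b) = c.op a + c.op b :=
  AddMonoidHom.ext fun x => by
    change c.incl ((a + b) * c.coord x) = c.incl (a * c.coord x) + c.incl (b * c.coord x)
    rw [add_mul, map_add]

theorem op_zero (c : Corner A) : c.op 0 = 0 :=
  AddMonoidHom.ext fun x => by
    change c.incl (0 * c.coord x) = 0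
    rw [zero_mul, map_zero]

theorem op_mem (c : Corner A) (a : A) : c.op a ∈ c.module.compacts := by
  rw [FMod.mem_compacts]
  induction A.quadratik a using AddSubgroup.closure_induction with
  | mem x hx =>
    obtain ⟨b, d, rfl⟩ := hx
    refine AddSubgroup.subset_closure ⟨c.incl b, _, c.mulLeft_coord_mem d,
      AddMonoidHom.ext fun x => ?_⟩
    change c.incl (b * d * c.coord x) = c.module.rsmul (c.incl b) (d * c.coord x)
    rw [mul_assoc, incl_mul]
  | zero => rw [op_zero]; exact zero_mem _
  | add x y _ _ hx hy => rw [op_add]; exact add_mem hx hy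
  | neg x _ hx =>
    have h : c.op (-x) = -c.op x := eq_neg_of_add_eq_zero_left (by
      rw [← op_add, neg_add_cancel, op_zero])
    rw [h]
    exact neg_mem hx

/-- The corner embedding `e : A → K_A(E ⊕ H_A)`, `e(a)(ξ ⊕ b ⊕ η) = 0 ⊕ a b ⊕ 0`. -/
def emb (c : Corner A) : RHom A c.target where
  toHom :=
    { toFun := fun a => (⟨c.op a, c.op_mem a⟩ : c.module.Compact)
      map_zero' := Subtype.ext c.op_zero
      map_add' := fun a b => Subtype.ext (c.op_add a b)
      map_mul' := fun a b => Subtype.ext <| AddMonoidHom.ext fun x => by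
        change c.incl (a * b * c.coord x) = c.incl (a * c.coord (c.incl (b * c.coord x)))
        rw [mul_assoc, coord_incl] }
  map_smul g a := Subtype.ext <| AddMonoidHom.ext fun x => by
    change c.incl ((g • a) * c.coord x) = g • c.incl (a * c.coord (g⁻¹ • x))
    rw [← incl_smul, coord_smul, A.smul_mul, smul_inv_smul]

end Corner

end Corner

/-! ### The category `GK^G` -/

section GK

variable {G : Type u} [Group G]

/-- Formal expressions in the generators of `GK^G`: equivariant ring homomorphisms, formal inverses
of corner embeddings, and formal splittings `Δ` of split exact sequences. Composition is written
from left to right. -/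
inductive Word : GRing G → GRing G → Type (u + 1)
  | hom {A B : GRing G} (f : RHom A B) : Word A B
  | cornerInv {A : GRing G} (c : Corner A) : Word c.target A
  | delta {B M A : GRing G} (s : SplitExact B M A) : Word M B
  | comp {A B C : GRing G} (x : Word A B) (y : Word B C) : Word A C
  | zero (A B : GRing G) : Word A B
  | add {A B : GRing G} (x y : Word A B) : Word A B
  | neg {A B : GRing G} (x : Word A B) : Word A B

open Word in
/-- The congruence on formal expressions generated by the axioms of a preadditive category and
the defining relations of `GK^G`. -/
inductive Rel : ∀ {A B : GRing G}, Word A B → Word A B → Prop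
  -- congruence
  | refl {A B} (x : Word A B) : Rel x x
  | symm {A B} {x y : Word A B} : Rel x y → Rel y x
  | trans {A B} {x y z : Word A B} : Rel x y → Rel y z → Rel x z
  | comp_congr {A B C} {x x' : Word A B} {y y' : Word B C} :
      Rel x x' → Rel y y' → Rel (comp x y) (comp x' y')
  | add_congr {A B} {x x' y y' : Word A B} : Rel x x' → Rel y y' → Rel (add x y) (add x' y')
  | neg_congr {A B} {x x' : Word A B} : Rel x x' → Rel (neg x) (neg x')
  -- free addition and subtraction
  | add_assoc {A B} (x y z : Word A B) : Rel (add (add x y) z) (add x (add y z))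
  | add_comm {A B} (x y : Word A B) : Rel (add x y) (add y x)
  | zero_add {A B} (x : Word A B) : Rel (add (zero A B) x) x
  | neg_add {A B} (x : Word A B) : Rel (add (neg x) x) (zero A B)
  | add_comp {A B C} (x y : Word A B) (z : Word B C) :
      Rel (comp (add x y) z) (add (comp x z) (comp y z))
  | comp_add {A B C} (x : Word A B) (y z : Word B C) :
      Rel (comp x (add y z)) (add (comp x y) (comp x z))
  -- category, ring category and units
  | comp_assoc {A B C D} (x : Word A B) (y : Word B C) (z : Word C D) :
      Rel (comp (comp x y) z) (comp x (comp y z))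
  | id_comp {A B} (x : Word A B) : Rel (comp (hom (RHom.id A)) x) x
  | comp_id {A B} (x : Word A B) : Rel (comp x (hom (RHom.id B))) x
  | hom_comp {A B C} (f : RHom A B) (g : RHom B C) :
      Rel (comp (hom f) (hom g)) (hom (f.comp g))
  -- additive category
  | prod (A B) : Rel (hom (RHom.id (A.prod B)))
      (add (comp (hom (projLeft A B)) (hom (inLeft A B)))
        (comp (hom (projRight A B)) (hom (inRight A B))))
  -- homotopy invariance
  | homotopy {A B} {f₀ f₁ : RHom A B} : Homotopic f₀ f₁ → Rel (hom f₀) (hom f₁)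
  -- stability
  | corner_inv {A} (c : Corner A) : Rel (comp (hom c.emb) (cornerInv c)) (hom (RHom.id A))
  | inv_corner {A} (c : Corner A) : Rel (comp (cornerInv c) (hom c.emb)) (hom (RHom.id c.target))
  -- split exactness
  | delta_left {B M A} (s : SplitExact B M A) : Rel (comp (hom s.j) (delta s)) (hom (RHom.id B))
  | delta_right {B M A} (s : SplitExact B M A) : Rel (hom (RHom.id M))
      (add (comp (delta s) (hom s.j)) (comp (hom s.f) (hom s.s)))

instance wordSetoid (A B : GRing G) : Setoid (Word A B) :=
  ⟨Rel, Rel.refl, Rel.symm, Rel.trans⟩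

/-- The group `GK^G(A, B)`. -/
def GKHom (A B : GRing G) : Type (u + 1) := Quotient (wordSetoid A B)

/-- The morphism in `GK^G` represented by a formal expression. -/
def Word.cls {A B : GRing G} (x : Word A B) : GKHom A B := Quotient.mk _ x

theorem Word.cls_eq {A B : GRing G} {x y : Word A B} (h : Rel x y) : x.cls = y.cls :=
  Quotient.sound h

instance (A B : GRing G) : Add (GKHom A B) :=
  ⟨Quotient.map₂ Word.add fun _ _ h _ _ k => Rel.add_congr h k⟩

instance (A B : GRing G) : Zero (GKHom A B) := ⟨(Word.zero A B).cls⟩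

instance (A B : GRing G) : Neg (GKHom A B) :=
  ⟨Quotient.map Word.neg fun _ _ h => Rel.neg_congr h⟩

instance (A B : GRing G) : AddCommGroup (GKHom A B) where
  add_assoc := by
    rintro ⟨x⟩ ⟨y⟩ ⟨z⟩
    exact Word.cls_eq (Rel.add_assoc x y z)
  zero_add := by
    rintro ⟨x⟩
    exact Word.cls_eq (Rel.zero_add x)
  add_zero := by
    rintro ⟨x⟩
    exact Word.cls_eq ((Rel.add_comm _ _).trans (Rel.zero_add x))
  nsmul := nsmulRec
  zsmul := zsmulRec
  neg_add_cancel := by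
    rintro ⟨x⟩
    exact Word.cls_eq (Rel.neg_add x)
  add_comm := by
    rintro ⟨x⟩ ⟨y⟩
    exact Word.cls_eq (Rel.add_comm x y)

/-- Composition in `GK^G`, from left to right. -/
def GKHom.comp {A B C : GRing G} : GKHom A B → GKHom B C → GKHom A C :=
  Quotient.map₂ Word.comp fun _ _ h _ _ k => Rel.comp_congr h k

variable (G) in
/-- The objects of the category `GK^G`: all quadratik `G`-rings. -/
structure GK where
  /-- The object of `GK^G` given by a `G`-ring. -/
  of ::
  ring : GRing G

instance : Category (GK G) where
  Hom X Y := GKHom X.ring Y.ring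
  id X := (Word.hom (RHom.id X.ring)).cls
  comp := GKHom.comp
  id_comp := by
    rintro X Y ⟨x⟩
    exact Word.cls_eq (Rel.id_comp x)
  comp_id := by
    rintro X Y ⟨x⟩
    exact Word.cls_eq (Rel.comp_id x)
  assoc := by
    rintro X Y Z W ⟨x⟩ ⟨y⟩ ⟨z⟩
    exact Word.cls_eq (Rel.comp_assoc x y z)

instance : Preadditive (GK G) where
  homGroup X Y := inferInstanceAs (AddCommGroup (GKHom X.ring Y.ring))
  add_comp := by
    rintro X Y Z ⟨x⟩ ⟨y⟩ ⟨z⟩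
    exact Word.cls_eq (Rel.add_comp x y z)
  comp_add := by
    rintro X Y Z ⟨x⟩ ⟨y⟩ ⟨z⟩
    exact Word.cls_eq (Rel.comp_add x y z)

/-- The morphism in `GK^G` represented by a formal expression. -/
def GK.ofWord {A B : GRing G} (x : Word A B) : GK.of A ⟶ GK.of B := x.cls

/-- The morphism in `GK^G` given by an equivariant ring homomorphism. -/
def GK.hom {A B : GRing G} (f : RHom A B) : GK.of A ⟶ GK.of B := GK.ofWord (Word.hom f)

theorem GK.hom_id (A : GRing G) : GK.hom (RHom.id A) = 𝟙 (GK.of A) := rfl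

theorem GK.hom_comp {A B C : GRing G} (f : RHom A B) (g : RHom B C) :
    GK.hom (f.comp g) = GK.hom f ≫ GK.hom g :=
  (Word.cls_eq (Rel.hom_comp f g)).symm

theorem GK.hom_homotopic {A B : GRing G} {f₀ f₁ : RHom A B} (h : Homotopic f₀ f₁) :
    GK.hom f₀ = GK.hom f₁ :=
  Word.cls_eq (Rel.homotopy h)

/-- The morphism `Δ_s` of `GK^G`. -/
def GK.delta {B M A : GRing G} (s : SplitExact B M A) : GK.of M ⟶ GK.of B := GK.ofWord (Word.delta s)

theorem GK.j_delta {B M A : GRing G} (s : SplitExact B M A) :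
    GK.hom s.j ≫ GK.delta s = 𝟙 (GK.of B) :=
  Word.cls_eq (Rel.delta_left s)

theorem GK.id_eq_delta {B M A : GRing G} (s : SplitExact B M A) :
    𝟙 (GK.of M) = GK.delta s ≫ GK.hom s.j + GK.hom s.f ≫ GK.hom s.s :=
  Word.cls_eq (Rel.delta_right s)

theorem GK.id_prod (A B : GRing G) : 𝟙 (GK.of (A.prod B)) =
    GK.hom (projLeft A B) ≫ GK.hom (inLeft A B) + GK.hom (projRight A B) ≫ GK.hom (inRight A B) :=
  Word.cls_eq (Rel.prod A B)

instance GK.isIso_emb {A : GRing G} (c : Corner A) : IsIso (GK.hom c.emb) :=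
  ⟨⟨GK.ofWord (Word.cornerInv c), Word.cls_eq (Rel.corner_inv c), Word.cls_eq (Rel.inv_corner c)⟩⟩

/-- A bijective equivariant ring homomorphism is invertible in `GK^G`. -/
theorem GK.isIso_of_bijective {A B : GRing G} (f : RHom A B) (hf : Function.Bijective f) :
    IsIso (GK.hom f) := by
  let e := Equiv.ofBijective f hf
  have he : ∀ a, f (e.symm a) = a := e.apply_symm_apply
  let k : RHom B A :=
    { toHom :=
        { toFun := e.symm
          map_zero' := hf.1 (by rw [he]; exact (map_zero f.toHom).symm)
          map_add' := fun a b => hf.1 (by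
            rw [he]; exact ((map_add f.toHom _ _).trans (congrArg₂ _ (he a) (he b))).symm)
          map_mul' := fun a b => hf.1 (by
            rw [he]; exact ((map_mul f.toHom _ _).trans (congrArg₂ _ (he a) (he b))).symm) }
      map_smul := fun g a => hf.1 (by
        rw [f.map_smul]; exact (he _).trans (congrArg _ (he a)).symm) }
  have h1 : f.comp k = RHom.id A := RHom.ext_apply fun a => e.symm_apply_apply a
  have h2 : k.comp f = RHom.id B := RHom.ext_apply fun a => e.apply_symm_apply a
  exact ⟨⟨GK.hom k, by rw [← GK.hom_comp, h1]; rfl, by rw [← GK.hom_comp, h2]; rfl⟩⟩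

end GK

/-! ### Functors out of `GK^G` -/

section Lift

variable {G : Type u} [Group G] {D : Type*} [Category D] [Preadditive D]

variable (G D) in
/-- The values of an additive functor on the generators of `GK^G`, satisfying the defining
relations. No value is needed for the formal inverses of corner embeddings. -/
structure LiftData where
  obj : GRing G → D
  map : ∀ {A B : GRing G}, RHom A B → (obj A ⟶ obj B)
  map_id : ∀ A : GRing G, map (RHom.id A) = 𝟙 (obj A)
  map_comp : ∀ {A B C : GRing G} (f : RHom A B) (g : RHom B C), map (f.comp g) = map f ≫ map g
  map_prod : ∀ A B : GRing G, 𝟙 (obj (A.prod B)) =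
    map (projLeft A B) ≫ map (inLeft A B) + map (projRight A B) ≫ map (inRight A B)
  homotopy : ∀ {A B : GRing G} {f₀ f₁ : RHom A B}, Homotopic f₀ f₁ → map f₀ = map f₁
  isIso : ∀ {A : GRing G} (c : Corner A), IsIso (map c.emb)
  delta : ∀ {B M A : GRing G}, SplitExact B M A → (obj M ⟶ obj B)
  delta_left : ∀ {B M A : GRing G} (s : SplitExact B M A), map s.j ≫ delta s = 𝟙 (obj B)
  delta_right : ∀ {B M A : GRing G} (s : SplitExact B M A),
    𝟙 (obj M) = delta s ≫ map s.j + map s.f ≫ map s.s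

namespace LiftData

variable (F : LiftData G D)

/-- The value on formal expressions; the formal inverse of a corner embedding `e` is sent to the
inverse of the value at `e`. -/
def eval : ∀ {A B : GRing G}, Word A B → (F.obj A ⟶ F.obj B)
  | _, _, .hom f => F.map f
  | _, _, .cornerInv c => haveI := F.isIso c; inv (F.map c.emb)
  | _, _, .delta s => F.delta s
  | _, _, .comp x y => eval x ≫ eval y
  | _, _, .zero _ _ => 0
  | _, _, .add x y => eval x + eval y
  | _, _, .neg x => -eval x

theorem eval_eq {A B : GRing G} {x y : Word A B} (h : Rel x y) : F.eval x = F.eval y := by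
  induction h with
  | refl x => rfl
  | symm _ ih => exact ih.symm
  | trans _ _ ih₁ ih₂ => exact ih₁.trans ih₂
  | comp_congr _ _ ih₁ ih₂ => simp only [eval, ih₁, ih₂]
  | add_congr _ _ ih₁ ih₂ => simp only [eval, ih₁, ih₂]
  | neg_congr _ ih => simp only [eval, ih]
  | add_assoc x y z => exact add_assoc _ _ _
  | add_comm x y => exact add_comm _ _
  | zero_add x => exact zero_add _
  | neg_add x => exact neg_add_cancel _
  | add_comp x y z => exact Preadditive.add_comp _ _ _ _ _ _
  | comp_add x y z => exact Preadditive.comp_add _ _ _ _ _ _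
  | comp_assoc x y z => exact Category.assoc _ _ _
  | id_comp x => simp only [eval, F.map_id, Category.id_comp]
  | comp_id x => simp only [eval, F.map_id, Category.comp_id]
  | hom_comp f g => exact (F.map_comp f g).symm
  | prod A B => exact (F.map_id _).trans (F.map_prod A B)
  | homotopy h => exact F.homotopy h
  | corner_inv c => have := F.isIso c; simp only [eval, F.map_id, IsIso.hom_inv_id]
  | inv_corner c => have := F.isIso c; simp only [eval, F.map_id, IsIso.inv_hom_id]
  | delta_left s => exact (F.delta_left s).trans (F.map_id _).symm
  | delta_right s => exact (F.map_id _).trans (F.delta_right s)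

/-- The additive functor on `GK^G` with the given values on generators. -/
def functor : GK G ⥤ D where
  obj X := F.obj X.ring
  map {X Y} := Quotient.lift F.eval fun _ _ h => F.eval_eq h
  map_id X := F.map_id X.ring
  map_comp := by
    rintro X Y Z ⟨x⟩ ⟨y⟩
    rfl

instance : F.functor.Additive where
  map_add := by
    rintro X Y ⟨x⟩ ⟨y⟩
    rfl

end LiftData

end Lift

/-! ### Restriction -/

section Res

variable {G : Type u} [Group G] (H : Subgroup G)

/-- Restriction of the action from `G` to the subgroup `H`. -/
def res (A : GRing G) : GRing H where
  carrier := A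
  smul_mul h a b := A.smul_mul (h : G) a b
  quadratik := A.quadratik

/-- Restriction of homomorphisms. -/
def resHom {A B : GRing G} (f : RHom A B) : RHom (res H A) (res H B) :=
  ⟨f.toHom, fun h a => f.map_smul (h : G) a⟩

/-- Restriction of functional modules. -/
def resFMod {A : GRing G} (E : FMod A) : FMod (res H A) where
  carrier := E
  rsmul := E.rsmul
  rsmul_mul := E.rsmul_mul
  smul_rsmul h ξ a := E.smul_rsmul (h : G) ξ a
  functionals := E.functionals
  map_rsmul := E.map_rsmul
  mul_mem := E.mul_mem
  conj_mem h φ hφ := E.conj_mem (h : G) φ hφ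

/-- Restriction of direct sums of copies of the ring. -/
def resSum {A : GRing G} (L : SumModule A) : SumModule (res H A) where
  J := L.J
  act := letI := L.act; inferInstanceAs (DistribMulAction H (L.J →₀ A))
  smul_rsmul h ξ a := L.smul_rsmul (h : G) ξ a
  conj_mem h φ := L.conj_mem (h : G) φ

/-- Restriction of corner embeddings. -/
def resCorner {A : GRing G} (c : Corner A) : Corner (res H A) where
  E := resFMod H c.E
  L := resSum H c.L
  cofull := c.cofull

/-- Restriction of split exact sequences. -/
def resSplit {B M A : GRing G} (s : SplitExact B M A) :
    SplitExact (res H B) (res H M) (res H A) where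
  j := resHom H s.j
  f := resHom H s.f
  s := resHom H s.s
  injective := s.injective
  exact := s.exact
  split := s.split

theorem resHomotopic {A B : GRing G} {f₀ f₁ : RHom A B} (h : Homotopic f₀ f₁) :
    Homotopic (resHom H f₀) (resHom H f₁) := by
  obtain ⟨F, hF, h0, h1⟩ := h
  exact ⟨F, fun g a => hF (g : G) a, h0, h1⟩

/-- The identification of the compact operators before and after restriction. -/
def resTarget {A : GRing G} (c : Corner A) : RHom (res H c.target) (resCorner H c).target where
  toHom :=
    { toFun := fun T => (⟨T.1, T.2⟩ : (resCorner H c).module.Compact)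
      map_zero' := rfl
      map_add' := fun _ _ => rfl
      map_mul' := fun _ _ => rfl }
  map_smul _ _ := rfl

theorem isIso_resHom_emb {A : GRing G} (c : Corner A) : IsIso (GK.hom (resHom H c.emb)) := by
  have hb : Function.Bijective (resTarget H c) := by
    refine ⟨fun S T h => h, fun T => ?_⟩
    refine FMod.compact_induction (E := (resCorner H c).module)
      (P := fun T => ∃ S, resTarget H c S = T) ⟨0, map_zero (resTarget H c).toHom⟩ ?_ ?_ ?_ T
    · rintro _ _ ⟨S, rfl⟩ ⟨S', rfl⟩
      exact ⟨S + S', map_add (resTarget H c).toHom S S'⟩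
    · rintro _ ⟨S, rfl⟩
      exact ⟨-S, map_neg (resTarget H c).toHom S⟩
    · intro η φ
      exact ⟨c.module.thetaC η ⟨φ.1, φ.2⟩, rfl⟩
  have := GK.isIso_of_bijective _ hb
  have h : GK.hom (resHom H c.emb) ≫ GK.hom (resTarget H c) = GK.hom (resCorner H c).emb := by
    rw [← GK.hom_comp]
    rfl
  exact IsIso.of_isIso_fac_right h

/-- The restriction functor `GK^G → GK^H`. -/
def resFunctor : GK G ⥤ GK H :=
  LiftData.functor
    { obj := fun A => GK.of (res H A)
      map := fun f => GK.hom (resHom H f)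
      map_id := fun _ => rfl
      map_comp := fun f g => GK.hom_comp (resHom H f) (resHom H g)
      map_prod := fun A B => GK.id_prod (res H A) (res H B)
      homotopy := fun h => GK.hom_homotopic (resHomotopic H h)
      isIso := fun c => isIso_resHom_emb H c
      delta := fun s => GK.delta (resSplit H s)
      delta_left := fun s => GK.j_delta (resSplit H s)
      delta_right := fun s => GK.id_eq_delta (resSplit H s) }

end Res

/-! ### Induction -/

section Ind

variable {G : Type u} [Group G] (H : Subgroup G)

section Group

variable (M : Type u) [AddCommGroup M] [DistribMulAction H M]

/-- The group of functions `f : G → M` with `f (g h) = h⁻¹ f(g)` for `h ∈ H` which vanish on all but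
finitely many cosets `g H`. -/
def indSubgroup : AddSubgroup (G → M) where
  carrier := {f | (∀ (g : G) (h : H), f (g * h) = h⁻¹ • f g) ∧
    {x : G ⧸ H | ∃ g : G, (g : G ⧸ H) = x ∧ f g ≠ 0}.Finite}
  zero_mem' := ⟨fun _ _ => (smul_zero _).symm, by simp⟩
  add_mem' := by
    rintro f k ⟨hf, hf'⟩ ⟨hk, hk'⟩
    refine ⟨fun g h => by simp [hf, hk], (hf'.union hk').subset ?_⟩
    rintro x ⟨g, rfl, hg⟩
    by_cases h : f g = 0
    · exact Or.inr ⟨g, rfl, fun h' => hg (by simp [h, h'])⟩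
    · exact Or.inl ⟨g, rfl, h⟩
  neg_mem' := by
    rintro f ⟨hf, hf'⟩
    refine ⟨fun g h => by simp [hf], hf'.subset ?_⟩
    rintro x ⟨g, rfl, hg⟩
    exact ⟨g, rfl, fun h => hg (by simp [h])⟩

/-- The induced group. -/
def Ind : Type u := indSubgroup H M

instance : AddCommGroup (Ind H M) := inferInstanceAs (AddCommGroup (indSubgroup H M))

instance : FunLike (Ind H M) G M := ⟨fun f => f.1, Subtype.val_injective⟩

end Group

section Lemmas

variable {H} {M : Type u} [AddCommGroup M] [DistribMulAction H M]

theorem Ind.ext {f k : Ind H M} (h : ∀ g, f g = k g) : f = k := DFunLike.ext f k h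

theorem Ind.map_mul (f : Ind H M) (g : G) (h : H) : f (g * h) = h⁻¹ • f g := f.2.1 g h

@[simp] theorem Ind.add_apply (f k : Ind H M) (g : G) : (f + k) g = f g + k g := rfl

@[simp] theorem Ind.zero_apply (g : G) : (0 : Ind H M) g = 0 := rfl

@[simp] theorem Ind.neg_apply (f : Ind H M) (g : G) : (-f) g = -f g := rfl

theorem Ind.finite (f : Ind H M) : {x : G ⧸ H | ∃ g : G, (g : G ⧸ H) = x ∧ f g ≠ 0}.Finite := f.2.2

/-- The action of `G` on induced groups by `(k f)(x) = f(k⁻¹ x)`. -/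
instance : DistribMulAction G (Ind H M) where
  smul k f := ⟨fun x => f (k⁻¹ * x), fun g h => by
    change f (k⁻¹ * (g * h)) = _
    rw [← mul_assoc, f.map_mul], by
    refine (f.finite.image (fun x => k • x)).subset ?_
    rintro x ⟨g, rfl, hg⟩
    exact ⟨((k⁻¹ * g : G) : G ⧸ H), ⟨_, rfl, hg⟩, by
      change ((k * (k⁻¹ * g) : G) : G ⧸ H) = _
      rw [mul_inv_cancel_left]⟩⟩
  one_smul f := Ind.ext fun g => by
    change f (1⁻¹ * g) = f g
    simp
  mul_smul k l f := Ind.ext fun g => by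
    change f ((k * l)⁻¹ * g) = f (l⁻¹ * (k⁻¹ * g))
    rw [mul_inv_rev, mul_assoc]
  smul_zero _ := rfl
  smul_add _ _ _ := rfl

theorem Ind.smul_apply (k : G) (f : Ind H M) (x : G) : (k • f) x = f (k⁻¹ * x) := rfl

/-- Evaluation at a group element. -/
def Ind.eval (g : G) : Ind H M →+ M where
  toFun f := f g
  map_zero' := rfl
  map_add' _ _ := rfl

open Classical in
/-- The function which is supported on `g H` and takes the value `h⁻¹ m` at `g h`. -/
def bumpFun (H : Subgroup G) {M : Type u} [AddCommGroup M] [DistribMulAction H M] (g : G) (m : M) :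
    G → M :=
  fun k => if h : g⁻¹ * k ∈ H then (⟨_, h⟩ : H)⁻¹ • m else 0

theorem bumpFun_of_mem (g : G) (m : M) {k : G} (h : g⁻¹ * k ∈ H) :
    bumpFun H g m k = (⟨_, h⟩ : H)⁻¹ • m := dif_pos h

theorem bumpFun_of_notMem (g : G) (m : M) {k : G} (h : g⁻¹ * k ∉ H) :
    bumpFun H g m k = 0 := dif_neg h

/-- The element of the induced group which is supported on `g H` and takes the value `m` at `g`. -/
def Ind.bump (g : G) : M →+ Ind H M where
  toFun m := ⟨bumpFun H g m, by
    intro k h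
    by_cases hk : g⁻¹ * k ∈ H
    · have hk' : g⁻¹ * (k * h) ∈ H := by rw [← mul_assoc]; exact H.mul_mem hk h.2
      rw [bumpFun_of_mem g m hk, bumpFun_of_mem g m hk', smul_smul, ← mul_inv_rev]
      congr 2
      exact Subtype.ext (mul_assoc _ _ _).symm
    · have hk' : g⁻¹ * (k * h) ∉ H := fun h' => hk (by
        rw [← mul_assoc] at h'
        exact (H.mul_mem_cancel_right h.2).1 h')
      rw [bumpFun_of_notMem g m hk, bumpFun_of_notMem g m hk', smul_zero], by
    refine (Set.finite_singleton (g : G ⧸ H)).subset ?_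
    rintro x ⟨k, rfl, hk⟩
    by_contra hne
    refine hk (bumpFun_of_notMem g m fun h => hne ?_)
    exact (QuotientGroup.eq.2 h).symm⟩
  map_zero' := Ind.ext fun k => by
    change bumpFun H g 0 k = (0 : M)
    unfold bumpFun
    split_ifs <;> simp
  map_add' m n := Ind.ext fun k => by
    change bumpFun H g (m + n) k = bumpFun H g m k + bumpFun H g n k
    unfold bumpFun
    split_ifs <;> simp

theorem Ind.bump_apply_mul (g : G) (m : M) (h : H) :
    Ind.bump (H := H) g m (g * h) = h⁻¹ • m := by
  have h1 : g⁻¹ * (g * h) ∈ H := by rw [inv_mul_cancel_left]; exact h.2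
  change bumpFun H g m _ = _
  rw [bumpFun_of_mem g m h1]
  congr 2
  exact Subtype.ext (inv_mul_cancel_left g (h : G))

theorem Ind.bump_apply_of_notMem {g k : G} (m : M) (h : g⁻¹ * k ∉ H) :
    Ind.bump (H := H) g m k = 0 := bumpFun_of_notMem g m h

theorem Ind.bump_apply_self (g : G) (m : M) : Ind.bump (H := H) g m g = m := by
  have := Ind.bump_apply_mul g m (1 : H)
  simpa using this

/-- To compare an induced function with a bump function it suffices to look at the coset. -/
theorem Ind.eq_bump {f : Ind H M} {g : G} {m : M} (h1 : f g = m)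
    (h2 : ∀ k, g⁻¹ * k ∉ H → f k = 0) : f = Ind.bump g m := by
  refine Ind.ext fun k => ?_
  by_cases hk : g⁻¹ * k ∈ H
  · have : k = g * (⟨_, hk⟩ : H) := (mul_inv_cancel_left g k).symm
    rw [this, f.map_mul, Ind.bump_apply_mul, h1]
  · rw [h2 k hk, Ind.bump_apply_of_notMem m hk]

theorem Ind.sum_apply {ι : Type*} (s : Finset ι) (f : ι → Ind H M) (g : G) :
    (∑ i ∈ s, f i) g = ∑ i ∈ s, f i g := map_sum (Ind.eval g) f s

theorem Ind.eq_sum (f : Ind H M) (s : Finset (G ⧸ H)) (hs : f.finite.toFinset ⊆ s) :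
    ∑ x ∈ s, Ind.bump x.out (f x.out) = f := by
  classical
  refine Ind.ext fun k => ?_
  rw [Ind.sum_apply, Finset.sum_eq_single (k : G ⧸ H)]
  · have hk : (k : G ⧸ H).out⁻¹ * k ∈ H := QuotientGroup.eq.1 (Quotient.out_eq _)
    obtain ⟨h, hh⟩ : ∃ h : H, k = (k : G ⧸ H).out * h :=
      ⟨⟨_, hk⟩, (mul_inv_cancel_left _ k).symm⟩
    generalize (k : G ⧸ H).out = l at hh
    rw [hh, Ind.bump_apply_mul, f.map_mul]
  · intro x _ hx
    refine Ind.bump_apply_of_notMem _ fun h => hx ?_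
    rw [← QuotientGroup.eq.2 h]
    exact (Quotient.out_eq x).symm
  · intro hk
    have h0 : f (k : G ⧸ H).out = 0 := by
      by_contra hne
      exact hk (hs (f.finite.mem_toFinset.2 ⟨_, Quotient.out_eq _, hne⟩))
    rw [h0, map_zero]
    rfl

theorem Ind.induction {P : Ind H M → Prop} (h0 : P 0) (hadd : ∀ f k, P f → P k → P (f + k))
    (hb : ∀ g m, P (Ind.bump g m)) (f : Ind H M) : P f := by
  rw [← Ind.eq_sum f _ subset_rfl]
  exact Finset.sum_induction _ P hadd h0 fun x _ => hb _ _

end Lemmas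


section IndRing

variable {H}

instance (A : GRing H) : Mul (Ind H A) :=
  ⟨fun f k => ⟨fun g => f g * k g, fun g h => by
    change f (g * h) * k (g * h) = h⁻¹ • (f g * k g)
    rw [f.map_mul, k.map_mul, A.smul_mul], f.finite.subset (by
    rintro x ⟨g, rfl, hg⟩
    exact ⟨g, rfl, fun h => hg (by
      change f g * k g = 0
      rw [h, zero_mul])⟩)⟩⟩

theorem Ind.mul_apply {A : GRing H} (f k : Ind H A) (g : G) : (f * k) g = f g * k g := rfl

instance (A : GRing H) : NonUnitalRing (Ind H A) where
  left_distrib f k l := Ind.ext fun g => mul_add (f g) (k g) (l g)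
  right_distrib f k l := Ind.ext fun g => add_mul (f g) (k g) (l g)
  zero_mul f := Ind.ext fun g => zero_mul (f g)
  mul_zero f := Ind.ext fun g => mul_zero (f g)
  mul_assoc f k l := Ind.ext fun g => mul_assoc (f g) (k g) (l g)

theorem Ind.bump_mul {A : GRing H} (g : G) (a b : A) :
    Ind.bump (H := H) g (a * b) = Ind.bump g a * Ind.bump g b :=
  (Ind.eq_bump (by rw [Ind.mul_apply, Ind.bump_apply_self, Ind.bump_apply_self])
    (fun k hk => by rw [Ind.mul_apply, Ind.bump_apply_of_notMem a hk, zero_mul])).symm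

end IndRing

/-- The induced `G`-ring, with pointwise operations. -/
def ind (A : GRing H) : GRing G where
  carrier := Ind H A
  smul_mul _ _ _ := rfl
  quadratik := by
    intro f
    induction f using Ind.induction with
    | h0 => exact zero_mem _
    | hadd f k hf hk => exact add_mem hf hk
    | hb g m =>
      induction A.quadratik m using AddSubgroup.closure_induction with
      | mem x hx =>
        obtain ⟨b, c, rfl⟩ := hx
        exact AddSubgroup.subset_closure ⟨_, _, Ind.bump_mul g b c⟩
      | zero => rw [map_zero]; exact zero_mem _
      | add x y _ _ hx hy => rw [map_add]; exact add_mem hx hy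
      | neg x _ hx => rw [map_neg]; exact neg_mem hx

/-- The induced homomorphism `f ↦ π ∘ f` on the underlying rings. -/
def indMap {A B : GRing H} (π : RHom A B) : Ind H A →ₙ+* Ind H B where
  toFun f := ⟨fun g => π (f g), fun g h => by
    change π (f (g * h)) = h⁻¹ • π (f g)
    rw [f.map_mul, π.map_smul], f.finite.subset (by
    rintro x ⟨g, rfl, hg⟩
    exact ⟨g, rfl, fun h => hg (by
      change π (f g) = 0
      rw [h]; exact map_zero π.toHom)⟩)⟩
  map_zero' := Ind.ext fun _ => map_zero π.toHom
  map_add' f k := Ind.ext fun g => map_add π.toHom (f g) (k g)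
  map_mul' f k := Ind.ext fun g => map_mul π.toHom (f g) (k g)

theorem indMap_apply {A B : GRing H} (π : RHom A B) (f : Ind H A) (g : G) :
    indMap H π f g = π (f g) := rfl

/-- The induced equivariant homomorphism `f ↦ π ∘ f`. -/
def indHom {A B : GRing H} (π : RHom A B) : RHom (ind H A) (ind H B) :=
  ⟨indMap H π, fun _ _ => rfl⟩

/-- The split exact sequence induced by a split exact sequence. -/
def indSplit {B M A : GRing H} (s : SplitExact B M A) :
    SplitExact (ind H B) (ind H M) (ind H A) where
  j := indHom H s.j
  f := indHom H s.f
  s := indHom H s.s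
  injective f k h := Ind.ext fun g => s.injective (DFunLike.congr_fun (F := Ind H M) h g)
  exact m := by
    change Ind H M at m
    constructor
    · intro hm
      have h1 : ∀ g, ∃ b : B, s.j b = m g := fun g =>
        (s.exact (m g)).1 (DFunLike.congr_fun (F := Ind H A) hm g)
      choose b hb using h1
      refine ⟨(⟨b, fun g h => s.injective ?_, m.finite.subset ?_⟩ : Ind H B), Ind.ext hb⟩
      · rw [hb, s.j.map_smul, hb, m.map_mul]
      · rintro x ⟨g, rfl, hg⟩
        refine ⟨g, rfl, fun h => hg (s.injective ?_)⟩
        rw [hb, h]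
        exact (map_zero s.j.toHom).symm
    · rintro ⟨b, rfl⟩
      exact Ind.ext fun g => (s.exact _).2 ⟨_, rfl⟩
  split a := Ind.ext fun g => s.split _

section Homotopy

variable {H}

theorem Ind.exists_finset_tensor {M : Type u} [AddCommGroup M] [DistribMulAction H M]
    {V : Type*} [AddCommGroup V] (t : Ind H M ⊗[ℤ] V) :
    ∃ s : Finset (G ⧸ H), ∀ s', s ⊆ s' →
      ∑ x ∈ s', LinearMap.rTensor V (Ind.bump (H := H) (M := M) x.out).toIntLinearMap
        (LinearMap.rTensor V (Ind.eval x.out).toIntLinearMap t) = t := by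
  classical
  induction t with
  | zero => exact ⟨∅, fun s' _ => by simp⟩
  | tmul f v =>
    refine ⟨f.finite.toFinset, fun s' hs => ?_⟩
    conv_rhs => rw [← Ind.eq_sum f s' hs, TensorProduct.sum_tmul]
    rfl
  | add x y hx hy =>
    obtain ⟨s₁, h₁⟩ := hx
    obtain ⟨s₂, h₂⟩ := hy
    refine ⟨s₁ ∪ s₂, fun s' hs => ?_⟩
    simp only [map_add, Finset.sum_add_distrib]
    rw [h₁ s' (Finset.union_subset_left hs), h₂ s' (Finset.union_subset_right hs)]

/-- Elements of `Ind M ⊗ V` are determined by their evaluations. -/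
theorem Ind.tensor_ext {M : Type u} [AddCommGroup M] [DistribMulAction H M]
    {V : Type*} [AddCommGroup V] {t t' : Ind H M ⊗[ℤ] V}
    (h : ∀ g, LinearMap.rTensor V (Ind.eval g).toIntLinearMap t =
      LinearMap.rTensor V (Ind.eval g).toIntLinearMap t') : t = t' := by
  rw [← sub_eq_zero]
  obtain ⟨s, hs⟩ := Ind.exists_finset_tensor (t - t')
  rw [← hs s subset_rfl]
  refine Finset.sum_eq_zero fun x _ => ?_
  rw [map_sub, h, sub_self, map_zero]

theorem Ind.eval_bump_tensor {M : Type u} [AddCommGroup M] [DistribMulAction H M]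
    {V : Type*} [AddCommGroup V] (g k : G) (t : M ⊗[ℤ] V) :
    LinearMap.rTensor V (Ind.eval k).toIntLinearMap
      (LinearMap.rTensor V (Ind.bump (H := H) (M := M) g).toIntLinearMap t) =
    LinearMap.rTensor V ((Ind.eval k).comp (Ind.bump (H := H) (M := M) g)).toIntLinearMap t := by
  induction t with
  | zero => simp
  | tmul f v => rfl
  | add x y hx hy => simp only [map_add, hx, hy]

theorem rTensor_mul {R S C : Type*} [NonUnitalRing R] [NonUnitalRing S] [CommRing C]
    (f : R →ₙ+* S) (t t' : R ⊗[ℤ] C) :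
    LinearMap.rTensor C (f : R →+ S).toIntLinearMap (t * t') =
      LinearMap.rTensor C (f : R →+ S).toIntLinearMap t *
        LinearMap.rTensor C (f : R →+ S).toIntLinearMap t' := by
  change LinearMap.rTensor C (f : R →+ S).toIntLinearMap (Algebra.TensorProduct.mul t t') =
      Algebra.TensorProduct.mul (LinearMap.rTensor C (f : R →+ S).toIntLinearMap t)
        (LinearMap.rTensor C (f : R →+ S).toIntLinearMap t')
  induction t with
  | zero => simp
  | add x y hx hy => simp only [map_add, LinearMap.add_apply, hx, hy]
  | tmul a v =>
    induction t' with
    | zero => simp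
    | add x y hx hy => simp only [map_add, hx, hy]
    | tmul b w => simp

/-- Evaluation at a group element as a ring homomorphism. -/
def Ind.evalRing {A : GRing H} (g : G) : Ind H A →ₙ+* A where
  toFun f := f g
  map_zero' := rfl
  map_add' _ _ := rfl
  map_mul' _ _ := rfl

theorem indHomotopic {A B : GRing H} {f₀ f₁ : RHom A B} (h : Homotopic f₀ f₁) :
    Homotopic (indHom H f₀) (indHom H f₁) := by
  obtain ⟨F, hF, h0, h1⟩ := h
  have key : ∀ f : Ind H A, ∃ t : Ind H B ⊗[ℤ] C(unitInterval, ℂ), ∀ g,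
      LinearMap.rTensor C(unitInterval, ℂ) (Ind.eval g).toIntLinearMap t = F (f g) := by
    intro f
    induction f using Ind.induction with
    | h0 => exact ⟨0, fun g => by rw [map_zero, Ind.zero_apply, map_zero]⟩
    | hadd f k hf hk =>
      obtain ⟨t, ht⟩ := hf
      obtain ⟨t', ht'⟩ := hk
      exact ⟨t + t', fun g => by rw [map_add, ht, ht', Ind.add_apply, map_add]⟩
    | hb g a =>
      refine ⟨LinearMap.rTensor _ (Ind.bump (H := H) (M := B) g).toIntLinearMap (F a),
        fun k => ?_⟩
      rw [Ind.eval_bump_tensor]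
      by_cases hk : g⁻¹ * k ∈ H
      · obtain ⟨h, rfl⟩ : ∃ h : H, k = g * h := ⟨⟨_, hk⟩, (mul_inv_cancel_left _ k).symm⟩
        have e : (Ind.eval (g * (h : G))).comp (Ind.bump (H := H) (M := B) g) =
            DistribSMul.toAddMonoidHom B h⁻¹ :=
          AddMonoidHom.ext fun b => Ind.bump_apply_mul g b h
        rw [e, ← hF, Ind.bump_apply_mul]
      · have e : (Ind.eval k).comp (Ind.bump (H := H) (M := B) g) = 0 :=
          AddMonoidHom.ext fun b => Ind.bump_apply_of_notMem b hk
        have e' : (0 : B →+ B).toIntLinearMap = 0 := rfl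
        rw [e, Ind.bump_apply_of_notMem a hk, map_zero, e', LinearMap.rTensor_zero]
        rfl
  choose Φ hΦ using key
  have hmul : ∀ (t t' : Ind H B ⊗[ℤ] C(unitInterval, ℂ)) (g : G),
      LinearMap.rTensor C(unitInterval, ℂ) (Ind.eval (M := B) g).toIntLinearMap (t * t') =
      LinearMap.rTensor C(unitInterval, ℂ) (Ind.eval (M := B) g).toIntLinearMap t *
        LinearMap.rTensor C(unitInterval, ℂ) (Ind.eval (M := B) g).toIntLinearMap t' :=
    fun t t' g => rTensor_mul (Ind.evalRing g) t t'
  have hend : ∀ (τ : unitInterval) (f' : RHom A B),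
      (∀ a : A, LinearMap.lTensor B (evalAt τ) (F a) = f' a ⊗ₜ[ℤ] (1 : ℂ)) →
      ∀ f : Ind H A, LinearMap.lTensor (Ind H B) (evalAt τ) (Φ f) =
        indMap H f' f ⊗ₜ[ℤ] (1 : ℂ) := by
    intro τ f' hf' f
    refine Ind.tensor_ext fun g => ?_
    have e : ∀ t : Ind H B ⊗[ℤ] C(unitInterval, ℂ),
        LinearMap.rTensor ℂ (Ind.eval g).toIntLinearMap
          (LinearMap.lTensor (Ind H B) (evalAt τ) t) =
        LinearMap.lTensor B (evalAt τ)
          (LinearMap.rTensor C(unitInterval, ℂ) (Ind.eval g).toIntLinearMap t) := by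
      intro t
      induction t with
      | zero => simp
      | tmul f v => rfl
      | add x y hx hy => simp only [map_add, hx, hy]
    rw [e, hΦ, hf']
    rfl
  let Φ' : Ind H A →ₙ+* Ind H B ⊗[ℤ] C(unitInterval, ℂ) :=
    { toFun := Φ
      map_zero' := Ind.tensor_ext fun g => by
        rw [hΦ, map_zero]; exact map_zero F
      map_add' := fun f k => Ind.tensor_ext fun g => by
        rw [map_add, hΦ, hΦ, hΦ]; exact map_add F _ _
      map_mul' := fun f k => Ind.tensor_ext fun g => by
        rw [hΦ]; exact (map_mul F _ _).trans (by rw [hmul, hΦ, hΦ]) }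
  have hΦ' : ∀ (k : G) (f : Ind H A), Φ (k • f) =
      LinearMap.rTensor C(unitInterval, ℂ)
        (DistribSMul.toAddMonoidHom (Ind H B) k).toIntLinearMap (Φ f) := by
    intro k f
    refine Ind.tensor_ext fun g => ?_
    have e : ∀ t : Ind H B ⊗[ℤ] C(unitInterval, ℂ),
        LinearMap.rTensor C(unitInterval, ℂ) (Ind.eval g).toIntLinearMap
          (LinearMap.rTensor C(unitInterval, ℂ)
            (DistribSMul.toAddMonoidHom (Ind H B) k).toIntLinearMap t) =
        LinearMap.rTensor C(unitInterval, ℂ) (Ind.eval (k⁻¹ * g)).toIntLinearMap t := by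
      intro t
      induction t with
      | zero => simp
      | tmul f v => rfl
      | add x y hx hy => simp only [map_add, hx, hy]
    rw [e, hΦ, hΦ]
    rfl
  exact ⟨Φ', hΦ', hend 0 f₀ h0, hend 1 f₁ h1⟩

end Homotopy

section Prod

theorem GK.inLeft_projRight {K : Type u} [Group K] (A B : GRing K) :
    GK.hom (inLeft A B) ≫ GK.hom (projRight A B) = 0 := by
  have h := congrArg (fun z => GK.hom (inLeft A B) ≫ z ≫ GK.hom (projRight A B)) (GK.id_prod A B)
  have h1 : GK.hom (inLeft A B) ≫ GK.hom (projLeft A B) = 𝟙 _ := (GK.hom_comp _ _).symm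
  have h2 : GK.hom (inRight A B) ≫ GK.hom (projRight A B) = 𝟙 _ := (GK.hom_comp _ _).symm
  simp only [Category.id_comp, Preadditive.add_comp, Preadditive.comp_add, Category.assoc, h2,
    Category.comp_id] at h
  rw [reassoc_of% h1] at h
  exact left_eq_add.1 h

/-- A homomorphism which vanishes identically is the zero morphism. -/
theorem GK.hom_eq_zero {K : Type u} [Group K] {A B : GRing K} (f : RHom A B) (hf : ∀ a, f a = 0) :
    GK.hom f = 0 := by
  rw [← GK.inLeft_projRight A B, ← GK.hom_comp]
  exact congrArg GK.hom (RHom.ext_apply fun a => hf a)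

theorem ind_id_prod (A B : GRing H) : 𝟙 (GK.of (ind H (A.prod B))) =
    GK.hom (indHom H (projLeft A B)) ≫ GK.hom (indHom H (inLeft A B)) +
      GK.hom (indHom H (projRight A B)) ≫ GK.hom (indHom H (inRight A B)) := by
  let s : SplitExact A (A.prod B) B :=
    { j := inLeft A B
      f := projRight A B
      s := inRight A B
      injective := fun a b h => congrArg Prod.fst h
      exact := fun m => by
        constructor
        · intro h
          exact ⟨projLeft A B m, Prod.ext rfl h.symm⟩
        · rintro ⟨b, rfl⟩
          rfl
      split := fun _ => rfl }
  have h := GK.id_eq_delta (indSplit H s)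
  have h1 : GK.hom (indSplit H s).j ≫ GK.hom (indHom H (projLeft A B)) = 𝟙 _ :=
    (GK.hom_comp _ _).symm
  have h2 : GK.hom (indSplit H s).s ≫ GK.hom (indHom H (projLeft A B)) = 0 := by
    rw [← GK.hom_comp]
    exact GK.hom_eq_zero _ fun _ => rfl
  have h3 : GK.hom (indHom H (projLeft A B)) = GK.delta (indSplit H s) := by
    have h4 := congrArg (fun z => z ≫ GK.hom (indHom H (projLeft A B))) h
    simp only [Category.id_comp, Preadditive.add_comp, Category.assoc, h1, h2,
      Limits.comp_zero, add_zero, Category.comp_id] at h4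
    exact h4
  rw [h3]
  exact h

end Prod

section Module

variable {H} {A : GRing H}

/-- Pointwise right multiplication. -/
def indRsmul (E : FMod A) : Ind H E →+ Ind H A →+ Ind H E :=
  AddMonoidHom.mk' (fun η => AddMonoidHom.mk' (fun a => ⟨fun g => E.rsmul (η g) (a g), fun g h => by
      change E.rsmul (η (g * h)) (a (g * h)) = h⁻¹ • E.rsmul (η g) (a g)
      rw [η.map_mul, a.map_mul, E.smul_rsmul], η.finite.subset (by
      rintro x ⟨g, rfl, hg⟩
      exact ⟨g, rfl, fun h => hg (by
        change E.rsmul (η g) (a g) = 0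
        rw [h, map_zero]; rfl)⟩)⟩)
    fun a b => Ind.ext fun g => map_add (E.rsmul (η g)) (a g) (b g))
  fun η ζ => AddMonoidHom.ext fun a => Ind.ext fun g => by
    change E.rsmul (η g + ζ g) (a g) = E.rsmul (η g) (a g) + E.rsmul (ζ g) (a g)
    rw [map_add, AddMonoidHom.add_apply]

theorem indRsmul_apply (E : FMod A) (η : Ind H E) (a : Ind H A) (g : G) :
    indRsmul E η a g = E.rsmul (η g) (a g) := rfl

theorem indRsmul_bump (E : FMod A) (g : G) (ξ : E) (a : Ind H A) :
    indRsmul E (Ind.bump g ξ) a = Ind.bump g (E.rsmul ξ (a g)) :=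
  Ind.eq_bump (by rw [indRsmul_apply, Ind.bump_apply_self])
    (fun k hk => by rw [indRsmul_apply, Ind.bump_apply_of_notMem ξ hk, map_zero]; rfl)

/-- The induced functional module. Its functional space consists of the elements of the group
induced from the functional space of `E`, evaluated pointwise. -/
def indFMod (E : FMod A) : FMod (ind H A) where
  carrier := Ind H E
  rsmul := indRsmul E
  rsmul_mul η a b := Ind.ext fun g => E.rsmul_mul _ _ _
  smul_rsmul _ _ _ := rfl
  functionals :=
    { carrier := {Φ : Ind H E →+ Ind H A | ∃ ψ : Ind H E.Dual, ∀ η g, Φ η g = (ψ g).1 (η g)}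
      zero_mem' := ⟨0, fun _ _ => rfl⟩
      add_mem' := by
        rintro Φ Φ' ⟨ψ, hψ⟩ ⟨ψ', hψ'⟩
        exact ⟨ψ + ψ', fun η g => congrArg₂ (· + ·) (hψ η g) (hψ' η g)⟩
      neg_mem' := by
        rintro Φ ⟨ψ, hψ⟩
        exact ⟨-ψ, fun η g => congrArg Neg.neg (hψ η g)⟩ }
  map_rsmul := by
    rintro Φ ⟨ψ, hψ⟩ η a
    refine Ind.ext fun g => (hψ _ g).trans (((E.map_rsmul _ (ψ g).2 _ _)).trans ?_)
    exact congrArg (· * _) (hψ η g).symm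
  mul_mem := by
    rintro a Φ ⟨ψ, hψ⟩
    change Ind H A at a
    refine ⟨⟨fun g => ⟨_, E.mul_mem (a g) (ψ g).1 (ψ g).2⟩, fun g h => ?_, ?_⟩, fun η g =>
      congrArg (a g * ·) (hψ η g)⟩
    · refine Subtype.ext (AddMonoidHom.ext fun ξ => ?_)
      change a (g * h) * (ψ (g * h)).1 ξ = h⁻¹ • (a g * (ψ g).1 (h⁻¹⁻¹ • ξ))
      rw [a.map_mul, ψ.map_mul, A.smul_mul]
      rfl
    · refine a.finite.subset ?_
      rintro x ⟨g, rfl, hg⟩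
      refine ⟨g, rfl, fun h => hg (Subtype.ext (AddMonoidHom.ext fun ξ => ?_))⟩
      change a g * (ψ g).1 ξ = 0
      rw [h, zero_mul]
  conj_mem := by
    rintro k Φ ⟨ψ, hψ⟩
    refine ⟨k • ψ, fun η g => (hψ (k⁻¹ • η) (k⁻¹ * g)).trans ?_⟩
    change (ψ (k⁻¹ * g)).1 (η (k⁻¹⁻¹ * (k⁻¹ * g))) = (ψ (k⁻¹ * g)).1 (η g)
    rw [inv_inv, mul_inv_cancel_left]

/-- The pointwise action of induced compact operators on the induced module. -/
def pointwise (E : FMod A) (T : Ind H E.Compact) : Ind H E →+ Ind H E where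
  toFun η := ⟨fun g => (T g).1 (η g), fun g h => by
    change (T (g * h)).1 (η (g * h)) = h⁻¹ • (T g).1 (η g)
    rw [T.map_mul, E.compact_smul_apply, η.map_mul, inv_inv, smul_inv_smul], η.finite.subset (by
    rintro x ⟨g, rfl, hg⟩
    exact ⟨g, rfl, fun h => hg (by
      change (T g).1 (η g) = 0
      rw [h]; exact map_zero (T g).1)⟩)⟩
  map_zero' := Ind.ext fun g => map_zero (T g).1
  map_add' η ζ := Ind.ext fun g => map_add (T g).1 (η g) (ζ g)

theorem pointwise_apply (E : FMod A) (T : Ind H E.Compact) (η : Ind H E) (g : G) :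
    pointwise E T η g = (T g).1 (η g) := rfl

theorem pointwise_bump (E : FMod A) (g : G) (T : E.Compact) (η : Ind H E) :
    pointwise E (Ind.bump g T) η = Ind.bump g (T.1 (η g)) :=
  Ind.eq_bump (by rw [pointwise_apply, Ind.bump_apply_self])
    (fun k hk => by rw [pointwise_apply, Ind.bump_apply_of_notMem T hk]; rfl)

/-- An identification of the induced module `Ind E` with a functional module `F`, compatible with
the functionals up to cutting down to cosets. -/
structure IndIso (E : FMod A) (F : FMod (ind H A)) where
  X : Ind H E ≃+ F
  map_smul : ∀ (k : G) η, X (k • η) = k • X η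
  map_rsmul : ∀ η (a : Ind H A), X (indRsmul E η a) = F.rsmul (X η) a
  extend : ∀ (g : G), ∀ φ ∈ E.functionals, ∃ φ' ∈ F.functionals,
    ∀ η, φ' (X η) = Ind.bump (H := H) g (φ (η g))
  restrict : ∀ (g : G), ∀ φ' ∈ F.functionals, ∃ φ ∈ E.functionals,
    ∀ η, Ind.eval (M := A) g (φ' (X η)) = φ (η g)

namespace IndIso

variable {E : FMod A} {F : FMod (ind H A)} (I : IndIso E F)

theorem cofull (I : IndIso E F) (hE : E.Cofull) : F.Cofull := by
  intro x
  obtain ⟨η, rfl⟩ := I.X.surjective x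
  induction η using Ind.induction with
  | h0 => rw [map_zero]; exact zero_mem _
  | hadd f k hf hk => rw [map_add]; exact add_mem hf hk
  | hb g ξ =>
    induction hE ξ using AddSubgroup.closure_induction with
    | mem ξ hξ =>
      obtain ⟨η, ζ, φ, hφ, rfl⟩ := hξ
      obtain ⟨φ', hφ', h⟩ := I.extend g φ hφ
      refine AddSubgroup.subset_closure
        ⟨I.X (Ind.bump g η), I.X (Ind.bump g ζ), φ', hφ', ?_⟩
      rw [h, Ind.bump_apply_self, ← I.map_rsmul, indRsmul_bump, Ind.bump_apply_self]
    | zero => rw [map_zero, map_zero]; exact zero_mem _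
    | add x y _ _ hx hy => rw [map_add, map_add]; exact add_mem hx hy
    | neg x _ hx => rw [map_neg, map_neg]; exact neg_mem hx

/-- The operator on `F` corresponding to an induced compact operator. -/
def op (T : Ind H E.Compact) : AddMonoid.End F :=
  (I.X : Ind H E →+ F).comp ((pointwise E T).comp (I.X.symm : F →+ Ind H E))

theorem op_X (T : Ind H E.Compact) (η : Ind H E) : I.op T (I.X η) = I.X (pointwise E T η) := by
  change I.X (pointwise E T (I.X.symm (I.X η))) = _
  rw [I.X.symm_apply_apply]

theorem ext_X {S T : AddMonoid.End F} (h : ∀ η, S (I.X η) = T (I.X η)) : S = T :=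
  AddMonoidHom.ext fun x => by
    obtain ⟨η, rfl⟩ := I.X.surjective x
    exact h η

theorem op_zero : I.op 0 = 0 := I.ext_X fun η => (I.op_X 0 η).trans (map_zero I.X)

theorem op_add (S T : Ind H E.Compact) : I.op (S + T) = I.op S + I.op T :=
  I.ext_X fun η => by
    refine (I.op_X _ η).trans (Eq.trans ?_ (congrArg₂ (· + ·) (I.op_X S η) (I.op_X T η)).symm)
    rw [← map_add]
    rfl

theorem op_neg (S : Ind H E.Compact) : I.op (-S) = -I.op S :=
  eq_neg_of_add_eq_zero_left (by rw [← op_add, neg_add_cancel, op_zero])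

theorem op_bump_theta (g : G) (ξ : E) (φ : E.Dual) {φ' : F →+ ind H A}
    (h : ∀ η, Ind.eval (M := A) g (φ' (I.X η)) = φ.1 (η g)) :
    I.op (Ind.bump g (E.thetaC ξ φ)) = F.theta (I.X (Ind.bump g ξ)) φ' :=
  I.ext_X fun η => by
    refine (I.op_X _ η).trans ?_
    rw [pointwise_bump]
    refine Eq.trans ?_ ((congrArg I.X (indRsmul_bump E g ξ (φ' (I.X η)))).symm.trans
      (I.map_rsmul _ _))
    exact congrArg (fun a => I.X (Ind.bump g (E.rsmul ξ a))) (h η).symm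

theorem op_mem (T : Ind H E.Compact) : I.op T ∈ F.compacts := by
  induction T using Ind.induction with
  | h0 => rw [op_zero]; exact zero_mem _
  | hadd f k hf hk => rw [op_add]; exact add_mem hf hk
  | hb g T =>
    induction T using FMod.compact_induction with
    | h0 => rw [map_zero, op_zero]; exact zero_mem _
    | hadd S T hS hT => rw [map_add, op_add]; exact add_mem hS hT
    | hneg S hS => rw [map_neg, op_neg]; exact neg_mem hS
    | hθ ξ φ =>
      obtain ⟨φ', hφ', h⟩ := I.extend g φ.1 φ.2
      exact FMod.mem_compacts.2 (AddSubgroup.subset_closure ⟨_, φ', hφ',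
        I.op_bump_theta g ξ φ fun η => by rw [h]; exact Ind.bump_apply_self g _⟩)

/-- The isomorphism `Ind K_A(E) ≅ K_{Ind A}(F)`. -/
def ringHom (hE : E.Cofull) (hF : F.Cofull) :
    RHom (ind H (E.compactRing hE)) (F.compactRing hF) where
  toHom :=
    { toFun := fun T => (⟨I.op T, I.op_mem T⟩ : F.Compact)
      map_zero' := Subtype.ext I.op_zero
      map_add' := fun S T => Subtype.ext (I.op_add S T)
      map_mul' := fun S T => Subtype.ext <| I.ext_X fun η => by
        refine (I.op_X _ η).trans (Eq.trans ?_ (congrArg (I.op S) (I.op_X T η)).symm)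
        exact (I.op_X S (pointwise E T η)).symm }
  map_smul k T := Subtype.ext <| I.ext_X fun η => by
    change Ind H E.Compact at T
    refine (I.op_X _ η).trans ?_
    change _ = k • I.op T (k⁻¹ • I.X η)
    rw [← I.map_smul, I.op_X, ← I.map_smul]
    refine congrArg I.X (Ind.ext fun g => ?_)
    change (T (k⁻¹ * g)).1 (η g) = (T (k⁻¹ * g)).1 (η (k⁻¹⁻¹ * (k⁻¹ * g)))
    rw [inv_inv, mul_inv_cancel_left]

theorem ringHom_bijective (hE : E.Cofull) (hF : F.Cofull) :
    Function.Bijective (I.ringHom hE hF) := by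
  constructor
  · intro S T h
    change Ind H E.Compact at S T
    refine Ind.ext fun g => Subtype.ext (AddMonoidHom.ext fun ξ => ?_)
    have h1 : I.op S = I.op T := congrArg Subtype.val h
    have h2 : pointwise E S (Ind.bump g ξ) = pointwise E T (Ind.bump g ξ) :=
      I.X.injective (by rw [← I.op_X, ← I.op_X, h1])
    have h3 := DFunLike.congr_fun h2 g
    rw [pointwise_apply, pointwise_apply, Ind.bump_apply_self] at h3
    exact h3
  · intro T
    refine FMod.compact_induction (P := fun T => ∃ S, I.ringHom hE hF S = T)
      ⟨0, map_zero (I.ringHom hE hF).toHom⟩ ?_ ?_ ?_ T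
    · rintro _ _ ⟨S, rfl⟩ ⟨S', rfl⟩
      exact ⟨S + S', map_add (I.ringHom hE hF).toHom S S'⟩
    · rintro _ ⟨S, rfl⟩
      exact ⟨-S, map_neg (I.ringHom hE hF).toHom S⟩
    · intro x φ'
      suffices h : ∃ S : Ind H E.Compact, I.op S = F.theta x φ'.1 by
        obtain ⟨S, hS⟩ := h
        exact ⟨S, Subtype.ext hS⟩
      obtain ⟨η, rfl⟩ := I.X.surjective x
      induction η using Ind.induction with
      | h0 =>
        refine ⟨0, I.op_zero.trans (AddMonoidHom.ext fun y => ?_)⟩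
        change 0 = F.rsmul (I.X 0) (φ'.1 y)
        simp
      | hadd f k hf hk =>
        obtain ⟨S, hS⟩ := hf
        obtain ⟨S', hS'⟩ := hk
        refine ⟨S + S', ?_⟩
        rw [op_add, hS, hS']
        refine AddMonoidHom.ext fun y => ?_
        change F.rsmul (I.X f) (φ'.1 y) + F.rsmul (I.X k) (φ'.1 y) =
          F.rsmul (I.X (f + k)) (φ'.1 y)
        simp
      | hb g ξ =>
        obtain ⟨φ, hφ, h⟩ := I.restrict g φ'.1 φ'.2
        exact ⟨_, I.op_bump_theta g ξ ⟨φ, hφ⟩ h⟩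

end IndIso

end Module

section IndCorner

variable {H} {A : GRing H}

/-- The empty direct sum of copies of a ring. -/
def emptySum (B : GRing G) : SumModule B where
  J := PEmpty
  act :=
    { smul := fun _ ξ => ξ
      one_smul := fun _ => rfl
      mul_smul := fun _ _ _ => rfl
      smul_zero := fun _ => rfl
      smul_add := fun _ _ _ => rfl }
  smul_rsmul _ _ _ := Subsingleton.elim _ _
  conj_mem g φ := by
    have h : ∀ ξ : PEmpty →₀ B, sumFunctional B PEmpty φ ξ = 0 := fun ξ => by
      rw [Subsingleton.elim ξ 0, map_zero]
    exact ⟨φ, fun ξ => (h ξ).trans ((congrArg (g • ·) (h _)).trans (smul_zero g)).symm⟩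

/-- The functional module over `Ind A` into which the induced corner embedding maps. -/
def indModule (c : Corner A) : FMod (ind H A) :=
  (indFMod (c.E.prod c.L.toFMod)).prod
    ((FMod.self (ind H A)).prod (emptySum (ind H A)).toFMod)

/-- The homomorphism of induced groups given by an equivariant homomorphism. -/
def Ind.mapHom {M N : Type u} [AddCommGroup M] [DistribMulAction H M] [AddCommGroup N]
    [DistribMulAction H N] (f : M →+ N) (hf : ∀ (h : H) (m : M), f (h • m) = h • f m) :
    Ind H M →+ Ind H N where
  toFun η := ⟨fun g => f (η g), fun g h => by
    change f (η (g * h)) = h⁻¹ • f (η g)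
    rw [η.map_mul, hf], η.finite.subset (by
    rintro x ⟨g, rfl, hg⟩
    exact ⟨g, rfl, fun h => hg (by
      change f (η g) = 0
      rw [h, map_zero])⟩)⟩
  map_zero' := Ind.ext fun _ => map_zero f
  map_add' η ζ := Ind.ext fun g => map_add f (η g) (ζ g)

theorem Ind.bump_mem_functionals (E : FMod A) (g : G) {φ : E →+ A} (hφ : φ ∈ E.functionals) :
    (Ind.bump (H := H) g).comp (φ.comp (Ind.eval g)) ∈ (indFMod (H := H) E).functionals := by
  let φ' : E.Dual := ⟨φ, hφ⟩
  refine ⟨Ind.bump g φ', fun η k => ?_⟩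
  change Ind.bump (H := H) g (φ (η g)) k = _
  by_cases hk : g⁻¹ * k ∈ H
  · obtain ⟨h, rfl⟩ : ∃ h : H, k = g * h := ⟨⟨_, hk⟩, (mul_inv_cancel_left _ k).symm⟩
    rw [Ind.bump_apply_mul, Ind.bump_apply_mul, E.dual_smul_apply, η.map_mul, inv_inv,
      smul_inv_smul]
  · rw [Ind.bump_apply_of_notMem _ hk, Ind.bump_apply_of_notMem _ hk]
    rfl

namespace Corner

variable (c : Corner A)

/-- The projection `ξ ⊕ b ⊕ η ↦ ξ ⊕ η`. -/
def rest : c.module →+ (c.E.prod c.L.toFMod) where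
  toFun x := (x.1, x.2.2)
  map_zero' := rfl
  map_add' _ _ := rfl

/-- The inclusion `ξ ⊕ η ↦ ξ ⊕ 0 ⊕ η`. -/
def restIncl : (c.E.prod c.L.toFMod) →+ c.module where
  toFun y := (y.1, ((0 : A), y.2))
  map_zero' := rfl
  map_add' _ _ := Prod.ext rfl (Prod.ext (add_zero (0 : A)).symm rfl)

theorem rest_smul (h : H) (x : c.module) : c.rest (h • x) = h • c.rest x := rfl

theorem restIncl_smul (h : H) (y : c.E.prod c.L.toFMod) :
    c.restIncl (h • y) = h • c.restIncl y :=
  Prod.ext rfl (Prod.ext (smul_zero (A := A) h).symm rfl)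

theorem restIncl_add_incl (x : c.module) : c.restIncl (c.rest x) + c.incl (c.coord x) = x :=
  Prod.ext (add_zero x.1) (Prod.ext (zero_add (c.coord x)) (add_zero x.2.2))

theorem rest_add (y : c.E.prod c.L.toFMod) (a : A) : c.rest (c.restIncl y + c.incl a) = y :=
  Prod.ext (add_zero y.1) (add_zero y.2)

theorem coord_add (y : c.E.prod c.L.toFMod) (a : A) : c.coord (c.restIncl y + c.incl a) = a :=
  zero_add a

/-- The reordering isomorphism `Ind(E ⊕ A ⊕ L) ≅ Ind(E ⊕ L) ⊕ Ind A ⊕ 0`. -/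
def indEquiv : Ind H c.module ≃+ indModule c where
  toFun η := (Ind.mapHom c.rest c.rest_smul η, (Ind.mapHom c.coord c.coord_smul η, 0))
  invFun x := Ind.mapHom c.restIncl c.restIncl_smul x.1 + Ind.mapHom c.incl c.incl_smul x.2.1
  left_inv η := Ind.ext fun g => c.restIncl_add_incl (η g)
  right_inv x := by
    refine Prod.ext (Ind.ext fun g => ?_) (Prod.ext (Ind.ext fun g => ?_) ?_)
    · exact c.rest_add _ _
    · exact c.coord_add _ _
    · exact Subsingleton.elim (α := PEmpty →₀ ind H A) _ _
  map_add' η ζ := Prod.ext (map_add _ η ζ) (Prod.ext (map_add _ η ζ) (add_zero _).symm)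

theorem indEquiv_apply (η : Ind H c.module) : c.indEquiv η =
    (Ind.mapHom c.rest c.rest_smul η, (Ind.mapHom c.coord c.coord_smul η, 0)) := rfl

/-- The identification of `Ind(E ⊕ H_A)` with `Ind(E ⊕ L) ⊕ Ind A ⊕ 0` as functional modules. -/
def indIso : IndIso c.module (indModule c) where
  X := c.indEquiv
  map_smul _ _ := rfl
  map_rsmul η a := by
    refine Prod.ext rfl (Prod.ext rfl ?_)
    exact Subsingleton.elim (α := PEmpty →₀ ind H A) _ _
  extend := by
    rintro g _ ⟨φ₁, h₁, _, ⟨_, ⟨a, rfl⟩, φ₃, h₃, rfl⟩, rfl⟩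
    refine ⟨_, ⟨_, Ind.bump_mem_functionals (c.E.prod c.L.toFMod) g ⟨φ₁, h₁, φ₃, h₃, rfl⟩, _,
      ⟨_, ⟨Ind.bump (H := H) g a, rfl⟩, 0, zero_mem _, rfl⟩, rfl⟩, fun η => ?_⟩
    have hm : Ind.bump (H := H) g a * Ind.mapHom c.coord c.coord_smul η =
        Ind.bump g (a * c.coord (η g)) :=
      Ind.eq_bump (by rw [Ind.mul_apply, Ind.bump_apply_self]; rfl)
        (fun k hk => by rw [Ind.mul_apply, Ind.bump_apply_of_notMem _ hk, zero_mul])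
    change Ind.bump (H := H) g (φ₁ (η g).1 + φ₃ (η g).2.2) +
      (Ind.bump (H := H) g a * Ind.mapHom c.coord c.coord_smul η + 0) =
      Ind.bump (H := H) g (φ₁ (η g).1 + (a * c.coord (η g) + φ₃ (η g).2.2))
    rw [hm, add_zero, ← map_add]
    congr 1
    abel
  restrict := by
    rintro g _ ⟨Φ, ⟨ψ, hψ⟩, _, ⟨_, ⟨a, rfl⟩, χ, _, rfl⟩, rfl⟩
    change Ind H A at a
    obtain ⟨φ₁, h₁, φ₃, h₃, h⟩ := (ψ g).2
    refine ⟨_, ⟨φ₁, h₁, _, ⟨_, ⟨a g, rfl⟩, φ₃, h₃, rfl⟩, rfl⟩, fun η => ?_⟩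
    have h0 : Ind.eval (M := A) g (χ 0) = 0 := congrArg (Ind.eval (M := A) g) (map_zero χ)
    have e : Ind.eval (M := A) g (Φ (Ind.mapHom c.rest c.rest_smul η)) =
        φ₁ (η g).1 + φ₃ (η g).2.2 := (hψ _ g).trans (DFunLike.congr_fun h _)
    change Ind.eval (M := A) g (Φ (Ind.mapHom c.rest c.rest_smul η)) +
      (a g * c.coord (η g) + Ind.eval (M := A) g (χ 0)) =
        φ₁ (η g).1 + (a g * c.coord (η g) + φ₃ (η g).2.2)
    rw [e, h0]
    abel

theorem indModule_cofull : (indModule c).Cofull := c.indIso.cofull c.cofull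

/-- The corner embedding of `Ind A` corresponding to a corner embedding of `A`. -/
def ind : Corner (GKTheory.ind H A) where
  E := indFMod (c.E.prod c.L.toFMod)
  L := emptySum _
  cofull := c.indModule_cofull

/-- The isomorphism `Ind K_A(E ⊕ H_A) ≅ K_{Ind A}(Ind(E ⊕ L) ⊕ Ind A)`. -/
def indTarget : RHom (GKTheory.ind H c.target) c.ind.target :=
  c.indIso.ringHom c.cofull c.indModule_cofull

theorem indHom_emb_comp : (indHom H c.emb).comp c.indTarget = c.ind.emb :=
  RHom.ext_apply fun a => by
    change Ind H A at a
    refine Subtype.ext (c.indIso.ext_X fun η => ?_)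
    refine (c.indIso.op_X _ η).trans ?_
    refine Prod.ext (Ind.ext fun g => ?_) (Prod.ext (Ind.ext fun g => ?_) ?_)
    · rfl
    · rfl
    · rfl

theorem isIso_indHom_emb : IsIso (GK.hom (indHom H c.emb)) := by
  have : IsIso (GK.hom c.indTarget) :=
    GK.isIso_of_bijective _ (c.indIso.ringHom_bijective c.cofull c.indModule_cofull)
  have h : GK.hom (indHom H c.emb) ≫ GK.hom c.indTarget = GK.hom c.ind.emb := by
    rw [← GK.hom_comp, indHom_emb_comp]
  exact IsIso.of_isIso_fac_right h

end Corner

end IndCorner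

/-- The induction functor `GK^H → GK^G`. -/
def indFunctor : GK H ⥤ GK G :=
  LiftData.functor
    { obj := fun A => GK.of (ind H A)
      map := fun f => GK.hom (indHom H f)
      map_id := fun _ => rfl
      map_comp := fun f g => GK.hom_comp (indHom H f) (indHom H g)
      map_prod := fun A B => ind_id_prod H A B
      homotopy := fun h => GK.hom_homotopic (indHomotopic h)
      isIso := fun c => c.isIso_indHom_emb
      delta := fun s => GK.delta (indSplit H s)
      delta_left := fun s => GK.j_delta (indSplit H s)
      delta_right := fun s => GK.id_eq_delta (indSplit H s) }

end Ind

end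

end GKTheory

open CategoryTheory TensorProduct

namespace GKTheory

universe u

noncomputable section

/-! ### Naturality can be tested on ring homomorphisms. -/

section Naturality

variable {G : Type u} [Group G] {D : Type*} [Category D] [Preadditive D]

/-! The adjunction is given by a unit, a counit and the triangle identities. The unit `A → Res Ind
A` extends `a` to the function supported on `H` with value `a` at `1`. The counit cannot be a ring
homomorphism in general: the formula `f ↦ ∑ g f(g)` over the cosets `gH` is additive but not
multiplicative. Instead, the terms `g f(g)` are placed in separate diagonal slots of a matrix ring
over `B`, indexed by the `G`-set `Option (G ⧸ H)`, that is `G/H` with one fixed point `none` added.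
The embedding of `B` as the entry at the fixed point becomes invertible in `GK^G` by stability
(`GK.isIso_cornerEntry`), and the counit is the diagonal map followed by the inverse of this
embedding.

Stability speaks of compact operators, not of matrices. The finitely supported matrices map onto the
compact operators of `⨁ B ⊕ B`, but the map can have a kernel when elements of `B` annihilate `B`
from the left. This kernel is exactly the left annihilator of the matrix ring, and a surjection with
such a kernel is invertible in `GK^G`: for every ring `R` the corner embedding `R → K_R(R)` is also
a surjection with that kernel (`GK.isIso_of_ker_eq_annihilator`).

Both triangle identities reduce to the statement that two diagonal embeddings given by a `2 × 2`
system of equivariant matrix units are homotopic (`MatrixUnits.homotopic_diag`). For `Res B`, the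
two embeddings are the entry at the fixed point and the entry at the coset `H`, which is fixed by
`H`. For `Ind A`, they are the entry at the fixed point and the map that cuts a function into its
restrictions to the cosets and spreads them along the diagonal.

Naturality of unit and counit has to be checked for ring homomorphisms only, because the remaining
generators `e⁻¹` and `Δ_s` are determined by ring homomorphisms (`GK.naturality_of_hom`). -/

theorem GK.hom_delta_eq_zero {B M A : GRing G} (s : SplitExact B M A) :
    GK.hom s.s ≫ GK.delta s = 0 := by
  have hs : GK.hom s.s ≫ GK.hom s.f = 𝟙 _ := by
    rw [← GK.hom_comp, ← GK.hom_id]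
    exact congrArg GK.hom (RHom.ext_apply s.split)
  -- Multiplying `1 = Δj + fs` by `s` on the left and `Δ` on the right, with `jΔ = 1` and `sf = 1`,
  -- gives `sΔ = sΔ + sΔ`.
  have h := congrArg (fun z => GK.hom s.s ≫ z ≫ GK.delta s) (GK.id_eq_delta s)
  simp only [Category.id_comp, Preadditive.add_comp, Preadditive.comp_add, Category.assoc,
    GK.j_delta, Category.comp_id] at h
  rw [reassoc_of% hs] at h
  exact left_eq_add.1 h

/-- A family of morphisms between additive functors on `GK^G` which is natural for ring
homomorphisms is natural for all morphisms. -/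
theorem GK.naturality_of_hom {F F' : GK G ⥤ D} [F.Additive] [F'.Additive]
    (η : ∀ A : GRing G, F.obj (GK.of A) ⟶ F'.obj (GK.of A))
    (h : ∀ {A B : GRing G} (f : RHom A B),
      F.map (GK.hom f) ≫ η B = η A ≫ F'.map (GK.hom f))
    {A B : GRing G} (x : GK.of A ⟶ GK.of B) : F.map x ≫ η B = η A ≫ F'.map x := by
  suffices hw : ∀ {A B : GRing G} (w : Word A B),
      F.map (GK.ofWord w) ≫ η B = η A ≫ F'.map (GK.ofWord w) by
    obtain ⟨w⟩ := x
    exact hw w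
  intro A B w
  induction w with
  | hom f => exact h f
  | @cornerInv A c =>
    have h1 : GK.hom c.emb ≫ GK.ofWord (Word.cornerInv c) = 𝟙 _ :=
      Word.cls_eq (Rel.corner_inv c)
    have h2 : GK.ofWord (Word.cornerInv c) ≫ GK.hom c.emb = 𝟙 _ :=
      Word.cls_eq (Rel.inv_corner c)
    -- A square that commutes for `e` commutes for its inverse: insert `F'(e) F'(e⁻¹)` on the right,
    -- move `e` across `η`, and cancel `F(e⁻¹) F(e)`.
    calc F.map (GK.ofWord (Word.cornerInv c)) ≫ η A
        = F.map (GK.ofWord (Word.cornerInv c)) ≫ η A ≫ F'.map (GK.hom c.emb) ≫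
            F'.map (GK.ofWord (Word.cornerInv c)) := by
          rw [← F'.map_comp, h1, F'.map_id, Category.comp_id]
      _ = F.map (GK.ofWord (Word.cornerInv c) ≫ GK.hom c.emb) ≫ η _ ≫
            F'.map (GK.ofWord (Word.cornerInv c)) := by
          rw [F.map_comp, Category.assoc, reassoc_of% (h c.emb)]
      _ = _ := by rw [h2, F.map_id, Category.id_comp]
  | @delta B M A s =>
    -- Expand `η F'(Δ)` by `1 = F(Δ)F(j) + F(f)F(s)` and move `j` and `s` across `η`. The first term
    -- becomes `F(Δ) η F'(jΔ) = F(Δ) η`; the second contains `F'(sΔ) = 0`.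
    have h0 := congrArg F.map (GK.id_eq_delta s)
    rw [F.map_id, F.map_add, F.map_comp, F.map_comp] at h0
    change _ ≫ η B = η M ≫ F'.map (GK.delta s)
    have e := congrArg (fun z => z ≫ η M ≫ F'.map (GK.delta s)) h0
    simp only [Category.id_comp, Preadditive.add_comp, Category.assoc] at e
    rw [e, reassoc_of% (h s.j), reassoc_of% (h s.s), ← F'.map_comp, ← F'.map_comp, GK.j_delta,
      GK.hom_delta_eq_zero, F'.map_id, F'.map_zero]
    simp only [Category.comp_id, Limits.comp_zero, add_zero]
    rfl
  | @comp A B C x y hx hy =>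
    change F.map (GK.ofWord x ≫ GK.ofWord y) ≫ _ = _ ≫ F'.map (GK.ofWord x ≫ GK.ofWord y)
    rw [F.map_comp, F'.map_comp, Category.assoc, hy, reassoc_of% hx]
  | zero A B =>
    change F.map (0 : GK.of A ⟶ GK.of B) ≫ _ = _ ≫ F'.map (0 : GK.of A ⟶ GK.of B)
    rw [F.map_zero, F'.map_zero, Limits.zero_comp, Limits.comp_zero]
  | add x y hx hy =>
    change F.map (GK.ofWord x + GK.ofWord y) ≫ _ = _ ≫ F'.map (GK.ofWord x + GK.ofWord y)
    rw [F.map_add, F'.map_add, Preadditive.add_comp, Preadditive.comp_add, hx, hy]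
  | neg x hx =>
    change F.map (-GK.ofWord x) ≫ _ = _ ≫ F'.map (-GK.ofWord x)
    rw [F.map_neg, F'.map_neg, Preadditive.neg_comp, Preadditive.comp_neg, hx]

end Naturality

/-! ### Homotopies between diagonal entries. -/

section Rotation

variable {G : Type u} [Group G] {A R : GRing G}

/-- A `2 × 2` system of matrix units over `A` in the ring `R`. -/
structure MatrixUnits (A R : GRing G) where
  e : Fin 2 → Fin 2 → A →+ R
  mul_same : ∀ i j k a b, e i j a * e j k b = e i k (a * b)
  mul_ne : ∀ i j j' k a b, j ≠ j' → e i j a * e j' k b = 0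
  map_smul : ∀ i j (g : G) a, e i j (g • a) = g • e i j a

namespace MatrixUnits

variable (E : MatrixUnits A R)

/-- The diagonal entries as equivariant homomorphisms. -/
def diag (i : Fin 2) : RHom A R where
  toHom := { E.e i i with map_mul' := fun a b => (E.mul_same i i i a b).symm }
  map_smul := E.map_smul i i

/-- The column of the rank one idempotents joining the two diagonal entries. -/
def column : Fin 2 → C(unitInterval, ℂ) :=
  ![⟨fun t => 1 - (t : ℝ), by fun_prop⟩, ⟨fun t => (t : ℝ), by fun_prop⟩]

/-- The row of the rank one idempotents joining the two diagonal entries. -/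
def row : Fin 2 → C(unitInterval, ℂ) :=
  ![⟨fun t => (1 - (t : ℝ)) * (1 + 2 * (t : ℝ)), by fun_prop⟩,
    ⟨fun t => (t : ℝ) * (3 - 2 * (t : ℝ)), by fun_prop⟩]

/-- The polynomials come from expanding `((1-t) + t)³ = 1`: the two terms divisible by `(1-t)²` add
up to `(1-t)²(1+2t)`, the other two to `t²(3-2t)`. Dividing by the column entries `1-t` and `t`
gives the row. No square roots or trigonometric functions are needed, as the row need not be the
adjoint of the column. -/
theorem row_mul_column : row 0 * column 0 + row 1 * column 1 = 1 := by
  ext t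
  simp [row, column]
  ring

/-- With column `c` and row `r`, the homotopy is `a ↦ ∑ e_ij(a) ⊗ c_i r_j`, the element `a` placed
at the rank one idempotent `c r`. It is multiplicative because `r c = 1`, equivariant because each
`e_ij` is, and `c r` is the first diagonal unit at `t = 0` and the second at `t = 1`. Units in `A`
or `R` play no role. -/
theorem homotopic_diag : Homotopic (E.diag 0) (E.diag 1) := by
  -- The sum over the inner index that arises in a product of two values of the homotopy.
  have key : ∀ (i k : Fin 2) (x : R),
      x ⊗ₜ[ℤ] (column i * row 0 * (column 0 * row k)) +
        x ⊗ₜ[ℤ] (column i * row 1 * (column 1 * row k)) = x ⊗ₜ[ℤ] (column i * row k) := by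
    intro i k x
    rw [← TensorProduct.tmul_add]
    congr 1
    linear_combination (column i * row k) * row_mul_column
  have h00 : evalAt 0 (column 0 * row 0) = 1 := by simp [evalAt, column, row]
  have h01 : evalAt 0 (column 0 * row 1) = 0 := by simp [evalAt, column, row]
  have h10 : evalAt 0 (column 1 * row 0) = 0 := by simp [evalAt, column, row]
  have h11 : evalAt 0 (column 1 * row 1) = 0 := by simp [evalAt, column, row]
  have k00 : evalAt 1 (column 0 * row 0) = 0 := by simp [evalAt, column, row]
  have k01 : evalAt 1 (column 0 * row 1) = 0 := by simp [evalAt, column, row]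
  have k10 : evalAt 1 (column 1 * row 0) = 0 := by simp [evalAt, column, row]
  have k11 : evalAt 1 (column 1 * row 1) = 1 := by
    simp [evalAt, column, row]
    norm_num
  refine ⟨{ toFun := fun a => ∑ i, ∑ j, E.e i j a ⊗ₜ[ℤ] (column i * row j)
            map_zero' := by simp
            map_add' := fun a b => by
              simp only [map_add, TensorProduct.add_tmul, Finset.sum_add_distrib]
            map_mul' := fun a b => ?_ }, fun g a => ?_, fun a => ?_, fun a => ?_⟩
  · simp only [Fin.sum_univ_two, add_mul, mul_add, Algebra.TensorProduct.tmul_mul_tmul,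
      E.mul_same, E.mul_ne _ 0 1 _ _ _ (by decide), E.mul_ne _ 1 0 _ _ _ (by decide),
      TensorProduct.zero_tmul, add_zero, zero_add]
    rw [← key 0 0, ← key 0 1, ← key 1 0, ← key 1 1]
    abel
  · change ∑ i, ∑ j, E.e i j (g • a) ⊗ₜ[ℤ] (column i * row j) =
      LinearMap.rTensor _ _ (∑ i, ∑ j, E.e i j a ⊗ₜ[ℤ] (column i * row j))
    simp only [map_sum, LinearMap.rTensor_tmul, E.map_smul]
    rfl
  · change LinearMap.lTensor _ _ (∑ i, ∑ j, E.e i j a ⊗ₜ[ℤ] (column i * row j)) = _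
    simp only [Fin.sum_univ_two, map_add, LinearMap.lTensor_tmul, h00, h01, h10, h11,
      TensorProduct.tmul_zero, add_zero]
    rfl
  · change LinearMap.lTensor _ _ (∑ i, ∑ j, E.e i j a ⊗ₜ[ℤ] (column i * row j)) = _
    simp only [Fin.sum_univ_two, map_add, LinearMap.lTensor_tmul, k00, k01, k10, k11,
      TensorProduct.tmul_zero, zero_add]
    rfl

end MatrixUnits

end Rotation

/-! ### Surjections with a common kernel. -/

section Annihilator

variable {G : Type u} [Group G]

/-- Surjections with the same kernel have isomorphic ranges. -/
theorem GK.isIso_of_ker_eq {R S T : GRing G} (f : RHom R S) (k : RHom R T)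
    (hf : Function.Surjective f) (hk : Function.Surjective k) (h : ∀ x, f x = 0 ↔ k x = 0)
    (hiso : IsIso (GK.hom k)) : IsIso (GK.hom f) := by
  have hsub : ∀ x y, f x = f y ↔ k x = k y := fun x y => by
    rw [← sub_eq_zero, ← sub_eq_zero (a := k x), ← map_sub, ← map_sub]
    exact h _
  let s := Function.surjInv hf
  have hs : ∀ y, f (s y) = y := Function.surjInv_eq hf
  have key : ∀ x, k (s (f x)) = k x := fun x => (hsub _ _).1 (hs _)
  -- The section `s` is only a map of sets, but `k` does not see which preimage under `f` was
  -- chosen. Hence `k ∘ s` respects all operations.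
  let l : RHom S T :=
    { toHom :=
        { toFun := fun y => k (s y)
          map_zero' := by
            refine ((hsub (s 0) 0).1 ?_).trans (map_zero k.toHom)
            rw [hs]; exact (map_zero f.toHom).symm
          map_add' := fun x y => by
            refine ((hsub _ (s x + s y)).1 ?_).trans (map_add k.toHom _ _)
            rw [hs]
            exact ((map_add f.toHom _ _).trans (congrArg₂ _ (hs x) (hs y))).symm
          map_mul' := fun x y => by
            refine ((hsub _ (s x * s y)).1 ?_).trans (map_mul k.toHom _ _)
            rw [hs]
            exact ((map_mul f.toHom _ _).trans (congrArg₂ _ (hs x) (hs y))).symm }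
      map_smul := fun g x => by
        refine ((hsub _ (g • s x)).1 ?_).trans (k.map_smul _ _)
        rw [hs, f.map_smul, hs] }
  have hl : IsIso (GK.hom l) := by
    refine GK.isIso_of_bijective l ⟨fun x y hxy => ?_, fun z => ?_⟩
    · rw [← hs x, ← hs y]
      exact (hsub _ _).2 hxy
    · obtain ⟨x, rfl⟩ := hk z
      exact ⟨f x, key x⟩
  have e : GK.hom f ≫ GK.hom l = GK.hom k := by
    rw [← GK.hom_comp]
    exact congrArg GK.hom (RHom.ext_apply key)
  exact IsIso.of_isIso_fac_right e

end Annihilator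

/-! ### Permutation actions on finitely supported functions. -/

section Perm

variable {G : Type u} [Group G] (I : Type u) [MulAction G I] (B : Type u) [AddCommGroup B]
  [DistribMulAction G B]

/-- The action of a group element on finitely supported functions, permuting coordinates and acting
on values. -/
def permMap (g : G) : (I →₀ B) →+ (I →₀ B) :=
  Finsupp.liftAddHom fun i =>
    (Finsupp.singleAddHom (g • i)).comp (DistribSMul.toAddMonoidHom B g)

variable {I B}

theorem permMap_single (g : G) (i : I) (b : B) :
    permMap I B g (Finsupp.single i b) = Finsupp.single (g • i) (g • b) := by
  simp [permMap]

theorem permMap_apply (g : G) (v : I →₀ B) (i : I) : permMap I B g v i = g • v (g⁻¹ • i) := by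
  classical
  induction v using Finsupp.induction_linear with
  | zero => simp
  | add v w hv hw => rw [map_add, Finsupp.add_apply, hv, hw, Finsupp.add_apply, smul_add]
  | single j b =>
    rw [permMap_single, Finsupp.single_apply, Finsupp.single_apply]
    simp only [eq_inv_smul_iff, smul_ite, smul_zero]

variable (I B)

/-- The action on finitely supported functions which permutes coordinates and acts on values. -/
@[reducible]
def permAction : DistribMulAction G (I →₀ B) where
  smul g v := permMap I B g v
  one_smul v := Finsupp.ext fun i => (permMap_apply _ _ _).trans (by simp)
  mul_smul g h v := Finsupp.ext fun i => by
    change permMap I B (g * h) v i = permMap I B g (permMap I B h v) i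
    rw [permMap_apply, permMap_apply, permMap_apply, mul_inv_rev, mul_smul, mul_smul]
  smul_zero g := map_zero (permMap I B g)
  smul_add g := map_add (permMap I B g)

end Perm

/-! ### Matrix rings indexed by a `G`-set. -/

section Matrix

variable {G : Type u} [Group G] (I : Type u) [MulAction G I]

/-- Finitely supported matrices with entries in `B` and indices in `I`. -/
def Mat (B : Type u) [AddCommGroup B] : Type u := (I × I) →₀ B

namespace Mat

instance (B : Type u) [AddCommGroup B] : AddCommGroup (Mat I B) :=
  inferInstanceAs (AddCommGroup ((I × I) →₀ B))

variable {I}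

/-- The matrix with at most one nonzero entry. -/
def single {B : Type u} [AddCommGroup B] (i j : I) : B →+ Mat I B := Finsupp.singleAddHom (i, j)

/-- The entries of a matrix. -/
def entry {B : Type u} [AddCommGroup B] (i j : I) : Mat I B →+ B := Finsupp.applyAddHom (i, j)

/-- The homomorphism on matrices determined by its values on matrices with one nonzero entry. -/
def lift {B N : Type u} [AddCommGroup B] [AddCommGroup N] (f : I → I → B →+ N) : Mat I B →+ N :=
  Finsupp.liftAddHom (M := B) fun p : I × I => f p.1 p.2

section

variable {B N : Type u} [AddCommGroup B] [AddCommGroup N]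

theorem lift_single (f : I → I → B →+ N) (i j : I) (b : B) : lift f (single i j b) = f i j b :=
  Finsupp.liftAddHom_apply_single (M := B) (fun p : I × I => f p.1 p.2) (i, j) b

theorem ext {S T : Mat I B} (h : ∀ i j, entry i j S = entry i j T) : S = T :=
  Finsupp.ext fun p => h p.1 p.2

theorem induction {P : Mat I B → Prop} (h0 : P 0) (hadd : ∀ S T, P S → P T → P (S + T))
    (hs : ∀ i j b, P (single i j b)) (T : Mat I B) : P T :=
  Finsupp.induction_linear (motive := P) T h0 hadd fun p b => hs p.1 p.2 b

open Classical in
theorem entry_single (i j k l : I) (b : B) :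
    entry i j (single k l b) = if k = i ∧ l = j then b else 0 := by
  change (Finsupp.single (k, l) b : (I × I) →₀ B) (i, j) = _
  rw [Finsupp.single_apply]
  simp only [Prod.mk.injEq]

end

open Classical in
/-- Matrix multiplication as a biadditive map. -/
def mulHom {B : Type u} [NonUnitalRing B] : Mat I B →+ Mat I B →+ Mat I B :=
  lift fun i j => AddMonoidHom.flip <| lift fun k l =>
    if j = k then AddMonoidHom.flip ((AddMonoidHom.mul (R := B)).compr₂ (single i l)) else 0

section

variable {B : Type u} [NonUnitalRing B]

instance : Mul (Mat I B) := ⟨fun S T => mulHom S T⟩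

theorem mul_def (S T : Mat I B) : S * T = mulHom S T := rfl

theorem single_mul_single (i j k : I) (a b : B) :
    single i j a * single j k b = single i k (a * b) := by
  rw [mul_def, mulHom, lift_single, AddMonoidHom.flip_apply, lift_single, if_pos rfl]
  rfl

theorem single_mul_single_of_ne (i : I) {j k : I} (l : I) (a b : B) (h : j ≠ k) :
    single i j a * single k l b = 0 := by
  rw [mul_def, mulHom, lift_single, AddMonoidHom.flip_apply, lift_single, if_neg h]
  rfl

instance : NonUnitalRing (Mat I B) where
  left_distrib S := map_add (mulHom S)
  right_distrib S T U := DFunLike.congr_fun (map_add mulHom S T) U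
  zero_mul S := DFunLike.congr_fun (map_zero mulHom) S
  mul_zero S := map_zero (mulHom S)
  mul_assoc S T U := by
    have hl : ∀ S T U : Mat I B, (S + T) * U = S * U + T * U :=
      fun S T U => DFunLike.congr_fun (map_add mulHom S T) U
    have hr : ∀ S T U : Mat I B, S * (T + U) = S * T + S * U := fun S => map_add (mulHom S)
    have zl : ∀ S : Mat I B, 0 * S = 0 := fun S => DFunLike.congr_fun (map_zero mulHom) S
    have zr : ∀ S : Mat I B, S * 0 = 0 := fun S => map_zero (mulHom S)
    induction S using Mat.induction with
    | h0 => simp only [zl]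
    | hadd S S' hS hS' => simp only [hl, hS, hS']
    | hs i j a =>
      induction U using Mat.induction with
      | h0 => simp only [zr]
      | hadd S S' hS hS' => simp only [hr, hS, hS']
      | hs k l c =>
        induction T using Mat.induction with
        | h0 => simp only [zr, zl]
        | hadd S S' hS hS' => simp only [hl, hr, hS, hS']
        | hs m n b =>
          by_cases h : j = m
          · subst h
            by_cases h' : n = k
            · subst h'
              simp only [single_mul_single, mul_assoc]
            · simp only [single_mul_single, single_mul_single_of_ne _ _ _ _ h', zr]
          · by_cases h' : n = k
            · subst h'
              simp only [single_mul_single, single_mul_single_of_ne _ _ _ _ h, zl]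
            · simp only [single_mul_single_of_ne _ _ _ _ h, single_mul_single_of_ne _ _ _ _ h',
                zl, zr]

end

section

variable {B : Type u} [AddCommGroup B] [DistribMulAction G B]

instance : DistribMulAction G (Mat I B) := permAction (G := G) (I × I) B

theorem smul_single (g : G) (i j : I) (b : B) :
    g • (single i j b) = single (g • i) (g • j) (g • b) :=
  permMap_single (I := I × I) (B := B) g (i, j) b

end

end Mat

/-- The ring of finitely supported matrices over `B` with indices in a `G`-set. -/
def matRing (B : GRing G) : GRing G where
  carrier := Mat I B
  smul_mul g S T := by
    induction S using Mat.induction with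
    | h0 => simp only [zero_mul, smul_zero]
    | hadd S S' hS hS' => simp only [add_mul, smul_add, hS, hS']
    | hs i j a =>
      induction T using Mat.induction with
      | h0 => simp only [mul_zero, smul_zero]
      | hadd S S' hS hS' => simp only [mul_add, smul_add, hS, hS']
      | hs k l b =>
        by_cases h : j = k
        · subst h
          simp only [Mat.smul_single, Mat.single_mul_single, B.smul_mul]
        · have h' : g • j ≠ g • k := fun e => h (MulAction.injective g e)
          simp only [Mat.smul_single, Mat.single_mul_single_of_ne _ _ _ _ h,
            Mat.single_mul_single_of_ne _ _ _ _ h', smul_zero]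
  quadratik T := by
    induction T using Mat.induction with
    | h0 => exact zero_mem _
    | hadd S T hS hT => exact add_mem hS hT
    | hs i j a =>
      induction B.quadratik a using AddSubgroup.closure_induction with
      | mem x hx =>
        obtain ⟨b, c, rfl⟩ := hx
        exact AddSubgroup.subset_closure ⟨_, _, (Mat.single_mul_single i j j b c).symm⟩
      | zero => rw [map_zero]; exact zero_mem _
      | add x y _ _ hx hy => rw [map_add]; exact add_mem hx hy
      | neg x _ hx => rw [map_neg]; exact neg_mem hx

namespace Mat

variable {I}

/-- Entrywise application of an additive map. -/
def map {B C : Type u} [AddCommGroup B] [AddCommGroup C] (f : B →+ C) : Mat I B →+ Mat I C :=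
  lift fun i j => (single i j).comp f

theorem map_single {B C : Type u} [AddCommGroup B] [AddCommGroup C] (f : B →+ C) (i j : I)
    (b : B) : map f (single i j b) = single i j (f b) :=
  lift_single _ i j b

theorem map_mul {B C : Type u} [NonUnitalRing B] [NonUnitalRing C] (f : B →ₙ+* C)
    (S T : Mat I B) : map (f : B →+ C) (S * T) = map (f : B →+ C) S * map (f : B →+ C) T := by
  induction S using Mat.induction with
  | h0 => simp only [zero_mul, map_zero]
  | hadd S S' hS hS' => simp only [add_mul, map_add, hS, hS']
  | hs i j a =>
    induction T using Mat.induction with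
    | h0 => simp only [mul_zero, map_zero]
    | hadd S S' hS hS' => simp only [mul_add, map_add, hS, hS']
    | hs k l b =>
      by_cases h : j = k
      · subst h
        simp only [map_single, single_mul_single, AddMonoidHom.coe_coe, _root_.map_mul]
      · simp only [map_single, single_mul_single_of_ne _ _ _ _ h, map_zero]

theorem map_smul {B C : Type u} [AddCommGroup B] [AddCommGroup C] [DistribMulAction G B]
    [DistribMulAction G C] (f : B →+ C) (g : G) (hf : ∀ b, f (g • b) = g • f b) (T : Mat I B) :
    map f (g • T) = g • map f T := by
  induction T using Mat.induction with
  | h0 => simp only [smul_zero, map_zero]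
  | hadd S S' hS hS' => simp only [smul_add, map_add, hS, hS']
  | hs i j a => simp only [smul_single, map_single, hf]

end Mat

/-- The homomorphism of matrix rings applying a homomorphism to the entries. -/
def matHom {B C : GRing G} (f : RHom B C) : RHom (matRing I B) (matRing I C) where
  toHom := { Mat.map (I := I) (f.toHom : B →+ C) with
    map_mul' := Mat.map_mul f.toHom }
  map_smul g T := Mat.map_smul (B := B) (C := C) (f.toHom : B →+ C) g (f.map_smul g) T

variable {I}

theorem matHom_single {B C : GRing G} (f : RHom B C) (i j : I) (b : B) :
    matHom I f (Mat.single i j b) = (Mat.single i j (f b) : Mat I C) :=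
  Mat.map_single (f.toHom : B →+ C) i j b

/-- The embedding of `B` as a diagonal entry with invariant index. -/
def cornerEntry (B : GRing G) (i : I) (hi : ∀ g : G, g • i = i) : RHom B (matRing I B) where
  toHom := { Mat.single i i with
    map_mul' := fun a b => (Mat.single_mul_single i i i a b).symm }
  map_smul g b := by
    refine Eq.trans ?_ (Mat.smul_single (B := B) g i i b).symm
    rw [hi]
    rfl

/-- This square is one half of the naturality of the counit; the other half is `diagHom_naturality`.
-/
theorem cornerEntry_comp {B C : GRing G} (f : RHom B C) (i : I) (hi : ∀ g : G, g • i = i) :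
    f.comp (cornerEntry C i hi) = (cornerEntry B i hi).comp (matHom I f) :=
  RHom.ext_apply fun b => (matHom_single f i i b).symm

end Matrix

/-! ### Matrices as operators on a column module. -/

section MatCorner

variable {G : Type u} [Group G] (J : Type u) [MulAction G J] (B : GRing G)

/-- The pairing of rows and columns is equivariant because both are moved by the same permutation.
It follows that conjugation preserves the functionals of finite support. -/
theorem sumFunctional_permMap (g : G) (φ v : J →₀ B) :
    sumFunctional B J (permMap J B g φ) v = g • sumFunctional B J φ (permMap J B g⁻¹ v) := by
  induction v using Finsupp.induction_linear with
  | zero => simp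
  | add v w hv hw => simp only [map_add, smul_add, hv, hw]
  | single j b =>
    rw [permMap_single, sumFunctional_single, sumFunctional_single, permMap_apply, B.smul_mul,
      smul_inv_smul]

/-- A direct sum of copies of `B` permuted by `G`, with the functionals of finite support. -/
def finModule : FMod B where
  carrier := J →₀ B
  action := permAction J B
  rsmul := sumRsmul B J
  rsmul_mul ξ a b := Finsupp.ext fun j => (mul_assoc (ξ j) a b).symm
  smul_rsmul g ξ a := by
    change permMap J B g (sumRsmul B J ξ a) = sumRsmul B J (permMap J B g ξ) (g • a)
    induction ξ using Finsupp.induction_linear with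
    | zero => simp
    | add x y hx hy => simp only [map_add, AddMonoidHom.add_apply, hx, hy]
    | single j b =>
      rw [sumRsmul_single, permMap_single, permMap_single, sumRsmul_single, B.smul_mul]
  functionals := ((sumFunctional B J).comp Finsupp.coeFnAddHom).range
  map_rsmul := by
    rintro _ ⟨φ, rfl⟩ ξ a
    change sumFunctional B J φ _ = sumFunctional B J φ _ * a
    induction ξ using Finsupp.induction_linear with
    | zero => simp
    | add x y hx hy => simp only [map_add, AddMonoidHom.add_apply, add_mul, hx, hy]
    | single j b => rw [sumRsmul_single, sumFunctional_single, sumFunctional_single, mul_assoc]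
  mul_mem := by
    rintro a _ ⟨φ, rfl⟩
    refine ⟨Finsupp.mapRange (a * ·) (mul_zero a) φ, AddMonoidHom.ext fun ξ => ?_⟩
    change sumFunctional B J _ ξ = a * sumFunctional B J φ ξ
    induction ξ using Finsupp.induction_linear with
    | zero => simp
    | add x y hx hy => simp only [map_add, mul_add, hx, hy]
    | single j b => rw [sumFunctional_single, sumFunctional_single, ← mul_assoc]; rfl
  conj_mem := by
    rintro g _ ⟨φ, rfl⟩
    exact ⟨permMap J B g φ, AddMonoidHom.ext fun ξ => sumFunctional_permMap J B g φ ξ⟩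

namespace MatCorner

/-- The module `⨁_J B ⊕ B ⊕ 0`. -/
def mod : FMod B := (finModule J B).prod ((FMod.self B).prod (emptySum B).toFMod)

variable {J B}

variable (J B) in
/-- The inclusion of the summand permuted by `G`. -/
def sumIncl : (J →₀ B) →+ mod J B := AddMonoidHom.inl (J →₀ B) (B × (PEmpty →₀ B))

/-- The inclusion of a coordinate; the invariant coordinate is the one with index `none`. -/
def col : Option J → B →+ mod J B
  | none => (AddMonoidHom.inr (J →₀ B) (B × (PEmpty →₀ B))).comp
      (AddMonoidHom.inl B (PEmpty →₀ B))
  | some j => (sumIncl J B).comp (Finsupp.singleAddHom j)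

/-- The projection to a coordinate. -/
def row : Option J → mod J B →+ B
  | none => (AddMonoidHom.fst B (PEmpty →₀ B)).comp
      (AddMonoidHom.snd (J →₀ B) (B × (PEmpty →₀ B)))
  | some j => (Finsupp.applyAddHom j).comp (AddMonoidHom.fst (J →₀ B) (B × (PEmpty →₀ B)))

theorem row_col_same (i : Option J) (b : B) : row i (col i b) = b := by
  cases i with
  | none => rfl
  | some j => exact Finsupp.single_eq_same

theorem row_col_ne {i j : Option J} (h : i ≠ j) (b : B) : row i (col j b) = 0 := by
  cases i with
  | none =>
    cases j with
    | none => exact absurd rfl h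
    | some j => rfl
  | some i =>
    cases j with
    | none => rfl
    | some j => exact Finsupp.single_eq_of_ne fun e => h (congrArg some e)

theorem eq_zero {x : mod J B} (h : ∀ i, row i x = 0) : x = 0 :=
  Prod.ext (Finsupp.ext fun j => h (some j))
    (Prod.ext (h none) (Subsingleton.elim (α := PEmpty →₀ B) _ _))

theorem col_mul (i : Option J) (a b : B) : col i (a * b) = (mod J B).rsmul (col i a) b := by
  cases i with
  | none =>
    refine Prod.ext ?_ (Prod.ext rfl (Subsingleton.elim (α := PEmpty →₀ B) _ _))
    change 0 = sumRsmul B J 0 b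
    simp
  | some j =>
    refine Prod.ext (sumRsmul_single B J j a b).symm
      (Prod.ext ?_ (Subsingleton.elim (α := PEmpty →₀ B) _ _))
    exact (zero_mul b).symm

theorem mulLeft_row_mem (i : Option J) (a : B) :
    (AddMonoidHom.mulLeft a).comp (row i) ∈ (mod J B).functionals := by
  cases i with
  | none =>
    refine ⟨0, zero_mem _, (AddMonoidHom.mulLeft a).coprod 0, ⟨_, ⟨a, rfl⟩, 0, zero_mem _, rfl⟩,
      AddMonoidHom.ext fun x => ?_⟩
    change a * row none x = 0 + (a * row none x + 0)
    rw [add_zero, zero_add]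
  | some j =>
    refine ⟨_, ⟨Finsupp.single j a, rfl⟩, 0, zero_mem _, AddMonoidHom.ext fun x => ?_⟩
    obtain ⟨v, x⟩ := x
    change J →₀ B at v
    change a * v j = sumFunctional B J (Finsupp.single j a) v + 0
    rw [add_zero]
    classical
    induction v using Finsupp.induction_linear with
    | zero => simp
    | add v w hv hw => rw [Finsupp.add_apply, mul_add, hv, hw, map_add]
    | single k b =>
      rw [sumFunctional_single, Finsupp.single_apply, Finsupp.single_apply]
      by_cases h : j = k
      · rw [if_pos h, if_pos h.symm]
      · rw [if_neg h, if_neg (Ne.symm h), mul_zero, zero_mul]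

theorem mod_induction {P : mod J B → Prop} (h0 : P 0) (hadd : ∀ x y, P x → P y → P (x + y))
    (hc : ∀ i b, P (col i b)) (x : mod J B) : P x := by
  obtain ⟨v, b, z⟩ := x
  have hv : ∀ v : J →₀ B, P (sumIncl J B v) := fun v => by
    induction v using Finsupp.induction_linear with
    | zero => exact h0
    | add v w hv hw => rw [map_add]; exact hadd _ _ hv hw
    | single j b => exact hc (some j) b
  have e : ((v, b, z) : mod J B) =
      sumIncl J B v + col none b :=
    Prod.ext (add_zero v).symm
      (Prod.ext (zero_add (M := B) b).symm (Subsingleton.elim (α := PEmpty →₀ B) _ _))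
  rw [e]
  exact hadd _ _ (hv v) (hc none b)

/-- Finite support of the functionals enters here: each is a finite sum of coordinate projections
multiplied by ring elements. Arbitrary families of coefficients would produce operators with
infinite rows, which no finitely supported matrix represents. -/
theorem functional_induction {P : (mod J B →+ B) → Prop} (h0 : P 0)
    (hadd : ∀ φ ψ, P φ → P ψ → P (φ + ψ))
    (hr : ∀ i (a : B), P ((AddMonoidHom.mulLeft a).comp (row i)))
    {φ : mod J B →+ B} (hφ : φ ∈ (mod J B).functionals) : P φ := by
  obtain ⟨_, ⟨v, rfl⟩, _, ⟨_, ⟨a, rfl⟩, χ, _, rfl⟩, rfl⟩ := hφ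
  -- The third summand of the module is zero, so its functional contributes nothing.
  have hχ : ∀ z : PEmpty →₀ B, χ z = 0 := fun z => by
    rw [Subsingleton.elim z 0]
    exact map_zero χ
  have hv : ∀ v : J →₀ B, P ((sumFunctional B J v).comp
      (AddMonoidHom.fst (J →₀ B) (B × (PEmpty →₀ B)))) := fun v => by
    induction v using Finsupp.induction_linear with
    | zero =>
      convert h0
      rw [Finsupp.coe_zero, map_zero]
      rfl
    | add v w hv hw =>
      convert hadd _ _ hv hw
      rw [Finsupp.coe_add, map_add]
      rfl
    | single j b =>
      convert hr (some j) b
      refine AddMonoidHom.ext fun x => ?_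
      obtain ⟨w, x⟩ := x
      change J →₀ B at w
      change sumFunctional B J (Finsupp.single j b) w = b * w j
      classical
      induction w using Finsupp.induction_linear with
      | zero => simp
      | add v w hv hw => rw [Finsupp.add_apply, mul_add, ← hv, ← hw, map_add]
      | single k c =>
        rw [sumFunctional_single, Finsupp.single_apply, Finsupp.single_apply]
        by_cases h : j = k
        · rw [if_pos h, if_pos h.symm]
        · rw [if_neg h, if_neg (Ne.symm h), mul_zero, zero_mul]
  refine (congrArg P (AddMonoidHom.ext (M := mod J B) (N := B) fun x => ?_)).mpr
    (hadd _ _ (hv v) (hr none a))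
  exact congrArg (sumFunctional B J v x.1 + ·)
    ((congrArg (a * row none x + ·) (hχ _)).trans (add_zero _))

variable (J B) in
-- A generator `η φ(ζ)` with `φ = c · row i` has the triple product `x c d` in its coordinate. The
-- quadratik property is therefore used twice, once for the element and once for its second factor.
theorem cofull : (mod J B).Cofull := by
  have key : ∀ (i : Option J) (x y : B), col i (x * y) ∈ AddSubgroup.closure
      {x : mod J B | ∃ η ζ : mod J B, ∃ φ ∈ (mod J B).functionals,
        x = (mod J B).rsmul η (φ ζ)} := fun i x y => by
    induction B.quadratik y using AddSubgroup.closure_induction with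
    | mem y hy =>
      obtain ⟨c, d, rfl⟩ := hy
      refine AddSubgroup.subset_closure ⟨col i x, col i d, _, mulLeft_row_mem i c, ?_⟩
      rw [col_mul]
      exact congrArg (fun z => (mod J B).rsmul (col i x) (c * z)) (row_col_same i d).symm
    | zero => rw [mul_zero, map_zero]; exact zero_mem _
    | add y z _ _ hy hz => rw [mul_add, map_add]; exact add_mem hy hz
    | neg y _ hy => rw [mul_neg, map_neg]; exact neg_mem hy
  intro x
  induction x using mod_induction with
  | h0 => exact zero_mem _
  | hadd x y hx hy => exact add_mem hx hy
  | hc i b =>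
    induction B.quadratik b using AddSubgroup.closure_induction with
    | mem y hy =>
      obtain ⟨c, d, rfl⟩ := hy
      exact key i c d
    | zero => rw [map_zero]; exact zero_mem _
    | add y z _ _ hy hz => rw [map_add]; exact add_mem hy hz
    | neg y _ hy => rw [map_neg]; exact neg_mem hy

theorem smul_col (g : G) (i : Option J) (b : B) : g • col i b = col (g • i) (g • b) := by
  cases i with
  | none =>
    exact Prod.ext (map_zero (permMap J B g))
      (Prod.ext rfl (Subsingleton.elim (α := PEmpty →₀ B) _ _))
  | some j =>
    exact Prod.ext (permMap_single (I := J) (B := B) g j b)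
      (Prod.ext (smul_zero g) (Subsingleton.elim (α := PEmpty →₀ B) _ _))

theorem row_smul (g : G) (i : Option J) (x : mod J B) : row (g • i) (g • x) = g • row i x := by
  induction x using mod_induction with
  | h0 => simp only [smul_zero, map_zero]
  | hadd x y hx hy => simp only [smul_add, map_add, hx, hy]
  | hc j b =>
    rw [smul_col]
    by_cases h : i = j
    · subst h
      rw [row_col_same, row_col_same]
    · rw [row_col_ne h, row_col_ne fun e => h (MulAction.injective g e), smul_zero]

theorem end_ext {S T : AddMonoid.End (mod J B)} (h : ∀ x, S x = T x) : S = T :=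
  AddMonoidHom.ext h

/-- The operator on the module given by a matrix. -/
def op : Mat (Option J) B →+ AddMonoid.End (mod J B) :=
  Mat.lift fun i j => AddMonoidHom.mk'
    (fun a => (col i).comp ((AddMonoidHom.mulLeft a).comp (row j)))
    fun a b => AddMonoidHom.ext fun x => by
      change col i ((a + b) * row j x) = col i (a * row j x) + col i (b * row j x)
      rw [add_mul, map_add]

theorem op_single (i j : Option J) (a : B) :
    op (Mat.single i j a) = (col i).comp ((AddMonoidHom.mulLeft a).comp (row j)) :=
  Mat.lift_single _ i j a

theorem op_single_apply (i j : Option J) (a : B) (x : mod J B) :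
    op (Mat.single i j a) x = col i (a * row j x) := by rw [op_single]; rfl

/-- An entry that is a product can be shared between the vector and the functional of an elementary
operator. In the absence of a unit, general entries reach the compact operators only as sums of such
products. -/
theorem op_mul_single (i j : Option J) (a b : B) :
    op (Mat.single i j (a * b)) =
      (mod J B).theta (col i a) ((AddMonoidHom.mulLeft b).comp (row j)) :=
  end_ext fun x => by
    rw [op_single_apply, mul_assoc, col_mul]
    rfl

theorem op_mem (T : Mat (Option J) B) : op T ∈ (mod J B).compacts := by
  induction T using Mat.induction with
  | h0 => rw [map_zero]; exact zero_mem _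
  | hadd S T hS hT => rw [map_add]; exact add_mem hS hT
  | hs i j a =>
    induction B.quadratik a using AddSubgroup.closure_induction with
    | mem x hx =>
      obtain ⟨b, c, rfl⟩ := hx
      exact FMod.mem_compacts.2 (AddSubgroup.subset_closure
        ⟨_, _, mulLeft_row_mem j c, op_mul_single i j b c⟩)
    | zero => rw [map_zero, map_zero]; exact zero_mem _
    | add x y _ _ hx hy => rw [map_add, map_add]; exact add_mem hx hy
    | neg x _ hx => rw [map_neg, map_neg]; exact neg_mem hx

theorem op_mul (S T : Mat (Option J) B) : op (S * T) = op S * op T := by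
  induction S using Mat.induction with
  | h0 => simp only [zero_mul, map_zero]
  | hadd S S' hS hS' => simp only [add_mul, map_add, hS, hS']
  | hs i j a =>
    induction T using Mat.induction with
    | h0 => simp only [mul_zero, map_zero]
    | hadd S S' hS hS' => simp only [mul_add, map_add, hS, hS']
    | hs k l b =>
      refine end_ext fun x => ?_
      change _ = op (Mat.single i j a) (op (Mat.single k l b) x)
      rw [op_single_apply, op_single_apply]
      by_cases h : j = k
      · subst h
        rw [Mat.single_mul_single, op_single_apply, row_col_same, mul_assoc]
      · rw [Mat.single_mul_single_of_ne _ _ _ _ h, row_col_ne h, mul_zero, map_zero, map_zero]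
        rfl

theorem op_smul (g : G) (T : Mat (Option J) B) : op (g • T) = (mod J B).conj g (op T) := by
  induction T using Mat.induction with
  | h0 => simp only [smul_zero, map_zero]
  | hadd S S' hS hS' => simp only [smul_add, map_add, hS, hS']
  | hs i j a =>
    refine end_ext fun x => ?_
    obtain ⟨y, rfl⟩ : ∃ y, x = g • y := ⟨g⁻¹ • x, (smul_inv_smul g x).symm⟩
    rw [FMod.conj_apply, inv_smul_smul, Mat.smul_single, op_single_apply, op_single_apply, row_smul,
      smul_col, B.smul_mul]

theorem row_op_col (T : Mat (Option J) B) (i k : Option J) (b : B) :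
    row i (op T (col k b)) = Mat.entry i k T * b := by
  induction T using Mat.induction with
  | h0 =>
    rw [map_zero, map_zero, zero_mul]
    exact map_zero (row i)
  | hadd S T hS hT =>
    rw [map_add, map_add, add_mul, ← hS, ← hT]
    exact map_add (row i) _ _
  | hs j l a =>
    rw [op_single_apply, Mat.entry_single]
    by_cases h : j = i
    · subst h
      rw [row_col_same]
      by_cases h' : l = k
      · subst h'
        rw [row_col_same, if_pos ⟨rfl, rfl⟩]
      · rw [row_col_ne h', if_neg fun e => h' e.2, mul_zero, zero_mul]
    · rw [row_col_ne (Ne.symm h), if_neg fun e => h e.1, zero_mul]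

/-- Applying `T` to columns and reading off coordinates only detects the products of entries of `T`
with elements of `B`. Nonzero entries may thus act as zero, and the matrix ring need not embed into
the compact operators. -/
theorem op_eq_zero_iff (T : Mat (Option J) B) :
    op T = 0 ↔ ∀ i k (b : B), Mat.entry i k T * b = 0 := by
  constructor
  · intro h i k b
    rw [← row_op_col, h]
    exact map_zero (row i)
  · intro h
    refine AddMonoidHom.ext fun x => ?_
    induction x using mod_induction with
    | h0 => exact (map_zero (op T)).trans (map_zero _).symm
    | hadd x y hx hy => exact (map_add (op T) x y).trans ((congrArg₂ _ hx hy).trans (add_zero _))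
    | hc k b => exact eq_zero fun i => (row_op_col T i k b).trans (h i k b)

end MatCorner

end MatCorner

/-! ### Left annihilators, and invertibility of the fixed matrix entry. -/

section Annihilator

variable {G : Type u} [Group G]

open Classical in
theorem Mat.entry_mul_single {I : Type u} {B : Type u} [NonUnitalRing B] (T : Mat I B)
    (i k l m : I) (b : B) :
    Mat.entry i m (T * Mat.single k l b) = if l = m then Mat.entry i k T * b else 0 := by
  induction T using Mat.induction with
  | h0 => simp only [zero_mul, map_zero, ite_self]
  | hadd S T hS hT =>
    rw [add_mul, map_add, hS, hT, map_add, add_mul]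
    split_ifs
    · rfl
    · exact add_zero 0
  | hs p q a =>
    rw [Mat.entry_single]
    by_cases h : q = k
    · subst h
      rw [Mat.single_mul_single, Mat.entry_single]
      by_cases h1 : p = i
      · simp only [h1, true_and, and_true, if_true]
      · simp only [h1, false_and, if_false, zero_mul, ite_self]
    · have h' : ¬(p = i ∧ q = k) := fun e => h e.2
      rw [Mat.single_mul_single_of_ne _ _ _ _ h, map_zero, if_neg h', zero_mul, ite_self]

/-- Testing on matrices with a single entry suffices. The purpose is to express the kernel of the
action on columns through the ring structure of the matrices alone. -/
theorem Mat.annihilates_iff {I : Type u} {B : Type u} [NonUnitalRing B] (T : Mat I B) :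
    (∀ S : Mat I B, T * S = 0) ↔ ∀ i k (b : B), Mat.entry i k T * b = 0 := by
  classical
  constructor
  · intro h i k b
    have := Mat.entry_mul_single T i k k k b
    rw [h, map_zero, if_pos rfl] at this
    exact this.symm
  · intro h S
    induction S using Mat.induction with
    | h0 => exact mul_zero T
    | hadd S S' hS hS' => rw [mul_add, hS, hS', add_zero]
    | hs k l b =>
      refine Mat.ext fun i m => ?_
      rw [Mat.entry_mul_single, h, ite_self, map_zero]

namespace MatCorner

variable (J : Type u) [MulAction G J] (B : GRing G)

/-- The corner embedding of `B` into the compact operators on `⨁_J B ⊕ B ⊕ 0`. -/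
def corner : Corner B where
  E := finModule J B
  L := emptySum B
  cofull := cofull J B

/-- The action of matrices on the module. -/
def toCompact : RHom (matRing (Option J) B) (corner J B).target where
  toHom :=
    { toFun := fun T => (⟨op T, op_mem T⟩ : (mod J B).Compact)
      map_zero' := Subtype.ext (map_zero op)
      map_add' := fun S T => Subtype.ext (map_add op S T)
      map_mul' := fun S T => Subtype.ext (op_mul S T) }
  map_smul g T := Subtype.ext (op_smul g T)

/-- By additivity in the vector and in the functional, only operators built from `col i b` and `a ·
row j` remain, and these come from the matrix with the single entry `b a` at `(i, j)`. -/
theorem toCompact_surjective : Function.Surjective (toCompact J B) := by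
  intro T
  refine FMod.compact_induction (E := mod J B) (P := fun T => ∃ S, toCompact J B S = T)
    ⟨0, map_zero (toCompact J B).toHom⟩ ?_ ?_ ?_ T
  · rintro _ _ ⟨S, rfl⟩ ⟨S', rfl⟩
    exact ⟨S + S', map_add (toCompact J B).toHom S S'⟩
  · rintro _ ⟨S, rfl⟩
    exact ⟨-S, map_neg (toCompact J B).toHom S⟩
  · intro x φ
    suffices h : ∃ S : Mat (Option J) B, op S = (mod J B).theta x φ.1 by
      obtain ⟨S, hS⟩ := h
      exact ⟨S, Subtype.ext hS⟩
    induction x using mod_induction with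
    | h0 =>
      refine ⟨0, (map_zero op).trans (AddMonoidHom.ext fun y => ?_)⟩
      change 0 = (mod J B).rsmul 0 (φ.1 y)
      rw [map_zero]
      rfl
    | hadd x y hx hy =>
      obtain ⟨S, hS⟩ := hx
      obtain ⟨T, hT⟩ := hy
      refine ⟨S + T, ?_⟩
      rw [map_add, hS, hT]
      refine AddMonoidHom.ext fun z => ?_
      change (mod J B).rsmul x (φ.1 z) + (mod J B).rsmul y (φ.1 z) =
        (mod J B).rsmul (x + y) (φ.1 z)
      rw [map_add]
      rfl
    | hc i b =>
      refine functional_induction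
        (P := fun φ => ∃ S : Mat (Option J) B, op S = (mod J B).theta (col i b) φ) ?_ ?_ ?_ φ.2
      · exact ⟨0, (map_zero op).trans (AddMonoidHom.ext fun y =>
          (map_zero ((mod J B).rsmul (col i b))).symm)⟩
      · rintro φ ψ ⟨S, hS⟩ ⟨T, hT⟩
        refine ⟨S + T, ?_⟩
        rw [map_add, hS, hT]
        exact AddMonoidHom.ext fun z => (map_add ((mod J B).rsmul (col i b)) _ _).symm
      · exact fun j a => ⟨_, op_mul_single i j b a⟩

theorem toCompact_eq_zero_iff (T : Mat (Option J) B) :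
    toCompact J B T = 0 ↔ ∀ S : Mat (Option J) B, T * S = 0 := by
  rw [Mat.annihilates_iff, ← op_eq_zero_iff]
  exact ⟨fun h => congrArg Subtype.val h, fun h => Subtype.ext h⟩

/-- The distinguished coordinate of the corner is the one with index `none`, so the corner embedding
factors through the matrix ring. -/
theorem cornerEntry_toCompact :
    (cornerEntry B (none : Option J) fun _ => rfl).comp (toCompact J B) = (corner J B).emb :=
  RHom.ext_apply fun b => Subtype.ext (op_single none none b)

end MatCorner

/-- The trivial action on the empty type. -/
@[reducible]
def emptyAction : MulAction G PEmpty.{u + 1} where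
  smul _ x := x
  one_smul _ := rfl
  mul_smul _ _ _ := rfl

/-- A surjection whose kernel is the left annihilator is invertible in `GK^G`. -/
theorem GK.isIso_of_ker_eq_annihilator {R S : GRing G} (f : RHom R S)
    (hf : Function.Surjective f) (h : ∀ x, f x = 0 ↔ ∀ y : R, x * y = 0) : IsIso (GK.hom f) := by
  let _ := emptyAction (G := G)
  let c := MatCorner.corner PEmpty R
  -- The comparison map is the corner embedding with zero complement, essentially `R → K_R(R)`. It
  -- is onto because a matrix with one index is a single element of `R`; it kills `x` exactly when
  -- `x R = 0`; and it is invertible by stability.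
  refine GK.isIso_of_ker_eq f c.emb hf ?_ ?_ (GK.isIso_emb c)
  · intro T
    obtain ⟨S, rfl⟩ := MatCorner.toCompact_surjective PEmpty R T
    change Mat (Option PEmpty) R at S
    induction S using Mat.induction with
    | h0 => exact ⟨0, (map_zero c.emb.toHom).trans
        (map_zero (MatCorner.toCompact PEmpty R).toHom).symm⟩
    | hadd S T hS hT =>
      obtain ⟨a, ha⟩ := hS
      obtain ⟨b, hb⟩ := hT
      exact ⟨a + b, (map_add c.emb.toHom a b).trans ((congrArg₂ _ ha hb).trans
        (map_add (MatCorner.toCompact PEmpty R).toHom S T).symm)⟩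
    | hs i j a =>
      refine ⟨a, ?_⟩
      obtain rfl : i = none := Subsingleton.elim _ _
      obtain rfl : j = none := Subsingleton.elim _ _
      exact congrArg (fun f : RHom R c.target => f a) (MatCorner.cornerEntry_toCompact PEmpty R).symm
  · intro x
    rw [h]
    constructor
    · intro hx
      refine Subtype.ext (AddMonoidHom.ext fun y => ?_)
      change c.incl (x * c.coord y) = 0
      rw [hx, map_zero]
    · intro hx y
      have h1 := congrArg (fun T : c.module.Compact => c.coord (T.1 (c.incl y))) hx
      exact h1

/-- The embedding of a ring as the invariant diagonal entry of matrices is invertible in `GK^G`. -/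
theorem GK.isIso_cornerEntry (J : Type u) [MulAction G J] (B : GRing G) :
    IsIso (GK.hom (cornerEntry B (none : Option J) fun _ => rfl)) := by
  -- The entry followed by the action on columns is a corner embedding. Both the action and the
  -- corner embedding are invertible, hence so is the entry.
  have := GK.isIso_of_ker_eq_annihilator (MatCorner.toCompact J B)
    (MatCorner.toCompact_surjective J B) (MatCorner.toCompact_eq_zero_iff J B)
  have h : GK.hom (cornerEntry B (none : Option J) fun _ => rfl) ≫
      GK.hom (MatCorner.toCompact J B) = GK.hom (MatCorner.corner J B).emb := by
    rw [← GK.hom_comp, MatCorner.cornerEntry_toCompact]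
  exact IsIso.of_isIso_fac_right h

end Annihilator

/-! ### Spreading a family over matrix positions. -/

section DiagSum

variable {G : Type u} [Group G] {I J : Type u}

/-- The matrix with entries `v x` at the positions `(p x, q x)`. -/
def Mat.diagSum {B : Type u} [AddCommGroup B] (p q : J → I) : (J →₀ B) →+ Mat I B :=
  Finsupp.liftAddHom (M := B) (N := Mat I B) fun x => Mat.single (p x) (q x)

theorem Mat.diagSum_single {B : Type u} [AddCommGroup B] (p q : J → I) (x : J) (b : B) :
    Mat.diagSum p q (Finsupp.single x b) = Mat.single (p x) (q x) b :=
  Finsupp.liftAddHom_apply_single (M := B) (N := Mat I B) (fun x => Mat.single (p x) (q x)) x b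

theorem Mat.diagSum_eq_sum {B : Type u} [AddCommGroup B] (p q : J → I) (v : J →₀ B)
    (s : Finset J) (hs : v.support ⊆ s) :
    Mat.diagSum p q v = ∑ x ∈ s, Mat.single (p x) (q x) (v x) :=
  Finsupp.sum_of_support_subset v hs (fun x b => Mat.single (p x) (q x) b) fun _ _ => map_zero _

/-- Cross terms `x ≠ y` survive only if their inner indices agree, which is where `h` is needed. For
injective `q` the hypothesis is vacuous; for constant `q` it asks that the families be orthogonal,
as restrictions of functions to different cosets are. -/
theorem Mat.diagSum_mul {B : Type u} [NonUnitalRing B] (p q r : J → I) (v w : J →₀ B)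
    (h : ∀ x y, x ≠ y → q x = q y → v x * w y = 0) :
    Mat.diagSum p q v * Mat.diagSum q r w = Mat.diagSum p r (v * w) := by
  classical
  have hvw : (v * w).support ⊆ v.support ∪ w.support := fun x hx => by
    refine Finset.mem_union_left _ (Finsupp.mem_support_iff.2 fun h0 => ?_)
    refine Finsupp.mem_support_iff.1 hx ?_
    rw [Finsupp.mul_apply, h0, zero_mul]
  rw [Mat.diagSum_eq_sum p q v _ Finset.subset_union_left,
    Mat.diagSum_eq_sum q r w _ Finset.subset_union_right, Mat.diagSum_eq_sum p r _ _ hvw,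
    Finset.sum_mul_sum]
  refine Finset.sum_congr rfl fun x hx => ?_
  rw [Finset.sum_eq_single x]
  · rw [Mat.single_mul_single, Finsupp.mul_apply]
  · intro y _ hy
    by_cases hq : q x = q y
    · rw [← hq, Mat.single_mul_single, h x y hy.symm hq, map_zero]
    · exact Mat.single_mul_single_of_ne _ _ _ _ hq
  · exact fun hx' => absurd hx hx'

theorem Mat.diagSum_mul_of_ne {B : Type u} [NonUnitalRing B] (p q q' r : J → I) (v w : J →₀ B)
    (h : ∀ x y, q x ≠ q' y) : Mat.diagSum p q v * Mat.diagSum q' r w = 0 := by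
  rw [Mat.diagSum_eq_sum p q v _ subset_rfl, Mat.diagSum_eq_sum q' r w _ subset_rfl,
    Finset.sum_mul_sum]
  exact Finset.sum_eq_zero fun x _ => Finset.sum_eq_zero fun y _ =>
    Mat.single_mul_single_of_ne _ _ _ _ (h x y)

theorem Mat.diagSum_permMap [MulAction G I] [MulAction G J] {B : Type u} [AddCommGroup B]
    [DistribMulAction G B] {p q : J → I} (hp : ∀ (g : G) x, p (g • x) = g • p x)
    (hq : ∀ (g : G) x, q (g • x) = g • q x) (g : G) (v : J →₀ B) :
    Mat.diagSum p q (permMap J B g v) = g • Mat.diagSum p q v := by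
  induction v using Finsupp.induction_linear with
  | zero => simp only [map_zero, smul_zero]
  | add v w hv hw => simp only [map_add, smul_add, hv, hw]
  | single x b => rw [permMap_single, Mat.diagSum_single, Mat.diagSum_single, Mat.smul_single, hp, hq]

theorem Mat.map_diagSum {B C : Type u} [AddCommGroup B] [AddCommGroup C] (f : B →+ C)
    (p q : J → I) (v : J →₀ B) :
    Mat.map f (Mat.diagSum p q v) = Mat.diagSum p q (Finsupp.mapRange.addMonoidHom f v) := by
  induction v using Finsupp.induction_linear with
  | zero => simp only [map_zero]
  | add v w hv hw => simp only [map_add, hv, hw]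
  | single x b =>
    rw [Mat.diagSum_single, Mat.map_single, Finsupp.mapRange.addMonoidHom_apply,
      Finsupp.mapRange_single, Mat.diagSum_single]

end DiagSum

/-! ### Decomposition of induced functions along cosets. -/

section Coeff

variable {G : Type u} [Group G] {H : Subgroup G}

theorem Ind.smul_bump {M : Type u} [AddCommGroup M] [DistribMulAction H M] (g k : G) (m : M) :
    g • Ind.bump (H := H) k m = Ind.bump (g * k) m :=
  Ind.eq_bump
    (by rw [Ind.smul_apply, inv_mul_cancel_left, Ind.bump_apply_self])
    (fun l hl => by
      rw [Ind.smul_apply]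
      refine Ind.bump_apply_of_notMem m fun h => hl ?_
      rwa [mul_inv_rev, mul_assoc])

/-- The translate of the bump at `1` is the bump at `h`. It lives on the same coset `hH = H`, and
its value at `1 = h h⁻¹` is `h m`. This is the `H`-equivariance of the unit. -/
theorem Ind.smul_bump_one {M : Type u} [AddCommGroup M] [DistribMulAction H M] (h : H) (m : M) :
    Ind.bump (H := H) 1 (h • m) = (h : G) • Ind.bump (H := H) 1 m := by
  rw [Ind.smul_bump, mul_one]
  refine (Ind.eq_bump ?_ fun k hk => Ind.bump_apply_of_notMem m fun h' => hk ?_).symm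
  · have := Ind.bump_apply_mul (H := H) (h : G) m h⁻¹
    rwa [Subgroup.coe_inv, mul_inv_cancel, inv_inv] at this
  · rw [inv_one, one_mul]
    simpa using H.mul_mem h.2 h'

theorem Ind.bump_mul_bump_of_ne {A : GRing H} {g k : G} (h : (g : G ⧸ H) ≠ k) (a b : A) :
    Ind.bump (H := H) g a * Ind.bump k b = 0 := Ind.ext fun l => by
  rw [Ind.mul_apply]
  by_cases hg : g⁻¹ * l ∈ H
  · rw [Ind.bump_apply_of_notMem (g := k) b fun hk => h ((QuotientGroup.eq.2 hg).trans
      (QuotientGroup.eq.2 hk).symm), mul_zero]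
    rfl
  · rw [Ind.bump_apply_of_notMem a hg, zero_mul]
    rfl

/-- The family `g H ↦ g φ(f(g))` for an equivariant homomorphism `φ`. -/
def Ind.coeff {M N : Type u} [AddCommGroup M] [DistribMulAction H M] [AddCommGroup N]
    [DistribMulAction G N] (φ : M →+ N) : Ind H M →+ (G ⧸ H →₀ N) where
  toFun f := Finsupp.onFinset f.finite.toFinset (fun x => x.out • φ (f x.out)) fun x hx =>
    f.finite.mem_toFinset.2 ⟨x.out, Quotient.out_eq x, fun h => hx (by
      rw [h, map_zero, smul_zero])⟩
  map_zero' := Finsupp.ext fun x => by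
    change x.out • φ 0 = 0
    rw [map_zero, smul_zero]
  map_add' f k := Finsupp.ext fun x => by
    change x.out • φ (f x.out + k x.out) = x.out • φ (f x.out) + x.out • φ (k x.out)
    rw [map_add, smul_add]

theorem Ind.coeff_apply {M N : Type u} [AddCommGroup M] [DistribMulAction H M] [AddCommGroup N]
    [DistribMulAction G N] (φ : M →+ N) (f : Ind H M) (x : G ⧸ H) :
    Ind.coeff φ f x = x.out • φ (f x.out) := rfl

theorem Ind.coeff_support_subset {M N : Type u} [AddCommGroup M] [DistribMulAction H M]
    [AddCommGroup N] [DistribMulAction G N] (φ : M →+ N) (f : Ind H M) :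
    (Ind.coeff φ f).support ⊆ f.finite.toFinset := fun x hx =>
  f.finite.mem_toFinset.2 ⟨x.out, Quotient.out_eq x, fun h => Finsupp.mem_support_iff.1 hx (by
    rw [Ind.coeff_apply, h, map_zero, smul_zero])⟩

section

variable {M N : Type u} [AddCommGroup M] [DistribMulAction H M] [AddCommGroup N]
  [DistribMulAction G N]

/-- Independence of the representative: replacing `g` by `g h` changes `φ(f(g))` by `h⁻¹`, which the
new outer factor `g h` compensates. -/
theorem Ind.coeff_apply_mk (φ : M →+ N) (hφ : ∀ (h : H) (m : M), φ (h • m) = (h : G) • φ m)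
    (f : Ind H M) (g : G) :
    Ind.coeff φ f (g : G ⧸ H) = g • φ (f g) := by
  obtain ⟨h, hh⟩ := QuotientGroup.mk_out_eq_mul H g
  rw [Ind.coeff_apply, hh, f.map_mul, hφ, smul_smul]
  congr 1
  simp

theorem Ind.coeff_smul (φ : M →+ N) (hφ : ∀ (h : H) (m : M), φ (h • m) = (h : G) • φ m) (g : G)
    (f : Ind H M) : Ind.coeff φ (g • f) = permMap (G ⧸ H) N g (Ind.coeff φ f) := by
  refine Finsupp.ext fun x => ?_
  obtain ⟨k, rfl⟩ := QuotientGroup.mk_surjective x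
  rw [permMap_apply, MulAction.Quotient.smul_coe, smul_eq_mul, Ind.coeff_apply_mk φ hφ,
    Ind.coeff_apply_mk φ hφ, Ind.smul_apply, smul_smul, mul_inv_cancel_left]

end

/-- Both sides are computed at the same chosen representative, so equivariance of `φ` is not needed.
-/
theorem Ind.coeff_mul {A : GRing H} {B : GRing G} (φ : A →ₙ+* B) (f k : Ind H A) :
    Ind.coeff (φ : A →+ B) (f * k) = Ind.coeff (φ : A →+ B) f * Ind.coeff (φ : A →+ B) k := by
  refine Finsupp.ext fun x => ?_
  rw [Finsupp.mul_apply, Ind.coeff_apply, Ind.coeff_apply, Ind.coeff_apply, Ind.mul_apply,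
    ← B.smul_mul]
  exact congrArg (x.out • ·) (_root_.map_mul φ _ _)

end Coeff

/-! ### Unit, counit and triangle identities. -/

section Adjunction

variable {G : Type u} [Group G] (H : Subgroup G)

/-- The inclusion of `A` into the restriction of `Ind A` as functions supported on `H`. -/
def unitHom (A : GRing H) : RHom A (res H (ind H A)) where
  toHom := { Ind.bump (H := H) (M := A) 1 with map_mul' := Ind.bump_mul 1 }
  map_smul := Ind.smul_bump_one

/-- The diagonal embedding of `Ind (Res B)` into matrices over `B`. -/
def diagHom (B : GRing G) : RHom (ind H (res H B)) (matRing (Option (G ⧸ H)) B) where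
  toHom :=
    { (Mat.diagSum some some).comp (Ind.coeff (H := H) (M := res H B) (AddMonoidHom.id B)) with
      map_mul' := fun f k =>
        (congrArg (Mat.diagSum (I := Option (G ⧸ H)) some some)
          (Ind.coeff_mul (A := res H B) (NonUnitalRingHom.id B) f k)).trans
        -- Different cosets occupy different diagonal positions, so no cross terms arise even though
        -- the values `g f(g)` for different cosets need not be orthogonal in `B`.
        (Mat.diagSum_mul some some some _ _ fun _ _ hxy h =>
          absurd (Option.some_injective _ h) hxy).symm }
  map_smul g f :=
    (congrArg (Mat.diagSum (I := Option (G ⧸ H)) some some)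
      (Ind.coeff_smul (M := res H B) (AddMonoidHom.id B) (fun _ _ => rfl) g f)).trans
    (Mat.diagSum_permMap (fun _ _ => rfl) (fun _ _ => rfl) g _)

variable {H} in
-- The homomorphism has to commute with coset representatives, which may lie outside `H`; this uses
-- its full `G`-equivariance.
theorem diagHom_naturality {B C : GRing G} (f : RHom B C) :
    (indHom H (resHom H f)).comp (diagHom H C) = (diagHom H B).comp (matHom _ f) :=
  RHom.ext_apply fun a => by
    change Ind H (res H B) at a
    refine Eq.trans ?_ (Mat.map_diagSum (f.toHom : B →+ C) _ _ _).symm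
    refine congrArg (Mat.diagSum some some) (Finsupp.ext fun x => ?_)
    exact (f.map_smul _ _).symm

/-- The embedding of `B` as the invariant diagonal entry of matrices. -/
def entryHom (B : GRing G) : RHom B (matRing (Option (G ⧸ H)) B) :=
  cornerEntry B none fun _ => rfl

instance isIso_entryHom (B : GRing G) : IsIso (GK.hom (entryHom H B)) :=
  GK.isIso_cornerEntry (G ⧸ H) B

/-- The value of the counit `Ind (Res B) → B`. -/
def counitApp (B : GRing G) : GK.of (ind H (res H B)) ⟶ GK.of B :=
  GK.hom (diagHom H B) ≫ inv (GK.hom (entryHom H B))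

/-- The diagonal map and the entry embedding are both natural through `matHom`, and naturality of
the embedding passes to its inverse. -/
theorem counitApp_naturality {B C : GRing G} (f : RHom B C) :
    GK.hom (indHom H (resHom H f)) ≫ counitApp H C = counitApp H B ≫ GK.hom f := by
  have h : GK.hom f ≫ GK.hom (entryHom H C) = GK.hom (entryHom H B) ≫ GK.hom (matHom _ f) := by
    rw [← GK.hom_comp, ← GK.hom_comp]
    exact congrArg GK.hom (cornerEntry_comp f none fun _ => rfl)
  rw [counitApp, counitApp, ← Category.assoc, ← GK.hom_comp, diagHom_naturality, GK.hom_comp,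
    IsIso.comp_inv_eq, Category.assoc, Category.assoc, h, IsIso.inv_hom_id_assoc]

/-- The matrix units over `Res B` joining the invariant entry and the entry of the trivial
coset. -/
def resUnits (B : GRing G) :
    MatrixUnits (res H B) (res H (matRing (Option (G ⧸ H)) B)) where
  e i j := Mat.single (B := B) ((![none, some ((1 : G) : G ⧸ H)] : Fin 2 → Option (G ⧸ H)) i)
    ((![none, some ((1 : G) : G ⧸ H)] : Fin 2 → Option (G ⧸ H)) j)
  mul_same i j k a b := Mat.single_mul_single _ _ _ _ _
  mul_ne i j j' k a b h := Mat.single_mul_single_of_ne _ _ _ _ (by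
    fin_cases j <;> fin_cases j' <;> simp at h ⊢)
  map_smul i j h b := by
    -- The coset `H` is fixed by `H`, though in general not by `G`; for this reason the rotation is
    -- available only after restriction.
    have key : ∀ i, (h : G) • (![none, some ((1 : G) : G ⧸ H)] : Fin 2 → Option (G ⧸ H)) i =
        (![none, some ((1 : G) : G ⧸ H)] : Fin 2 → Option (G ⧸ H)) i := by
      intro i
      fin_cases i
      · rfl
      · refine congrArg some ?_
        change (((h : G) * 1 : G) : G ⧸ H) = ((1 : G) : G ⧸ H)
        rw [mul_one]
        exact QuotientGroup.eq.2 (by simp)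
    refine Eq.trans ?_ (Mat.smul_single (B := B) (h : G) _ _ b).symm
    rw [key, key]
    rfl

/-- The function on `H` generated by `b` takes the value `g⁻¹ b` at `g ∈ H`, and multiplying by `g`
gives back `b`. Only the diagonal slot of the coset `H` is filled. -/
theorem unitHom_comp_diagHom (B : GRing G) :
    (unitHom H (res H B)).comp (resHom H (diagHom H B)) = (resUnits H B).diag 1 :=
  RHom.ext_apply fun b => by
    change B at b
    refine Eq.trans ?_ (Mat.diagSum_single (B := B) some some ((1 : G) : G ⧸ H) b)
    refine congrArg (Mat.diagSum (B := B) some some) (Finsupp.ext fun x => ?_)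
    classical
    obtain ⟨g, rfl⟩ := QuotientGroup.mk_surjective x
    refine (Ind.coeff_apply_mk (M := res H B) (AddMonoidHom.id B) (fun _ _ => rfl) _ g).trans ?_
    change (fun z : B => g • z) (Ind.bump (H := H) (M := res H B) 1 b g) = _
    rw [Finsupp.single_apply]
    by_cases hg : g ∈ H
    · rw [if_pos (QuotientGroup.eq.2 (by simpa using hg))]
      have := Ind.bump_apply_mul (H := H) (M := res H B) 1 b ⟨g, hg⟩
      rw [one_mul] at this
      exact (congrArg (fun z : B => g • z) this).trans (smul_inv_smul g b)
    · rw [if_neg fun e => hg (by simpa using QuotientGroup.eq.1 e)]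
      exact (congrArg (fun z : B => g • z) (Ind.bump_apply_of_notMem (H := H) (M := res H B) b
        (by simpa using hg))).trans (smul_zero (A := B) g)

/-- The matrix units over `Ind A` joining the invariant entry and the entry spread out over the
cosets. -/
def indUnits (A : GRing H) :
    MatrixUnits (ind H A) (matRing (Option (G ⧸ H)) (ind H A)) where
  e i j := (Mat.diagSum ((![fun _ => none, some] : Fin 2 → G ⧸ H → Option (G ⧸ H)) i)
    ((![fun _ => none, some] : Fin 2 → G ⧸ H → Option (G ⧸ H)) j)).comp
      (Ind.coeff (H := H) (M := A) (N := Ind H A) (Ind.bump 1))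
  mul_same i j k a b := by
    change Ind H A at a b
    -- The index `none` collects the contributions of all cosets, so cross terms do occur. They
    -- vanish because restrictions to different cosets have disjoint supports.
    refine (Mat.diagSum_mul _ _ _ _ _ fun x y hxy _ => ?_).trans (congrArg (Mat.diagSum _ _)
      (Ind.coeff_mul (A := A) (B := ind H A) (unitHom H A).toHom a b).symm)
    change (x.out • Ind.bump (H := H) 1 (a x.out)) * (y.out • Ind.bump (H := H) 1 (b y.out)) = 0
    rw [Ind.smul_bump, Ind.smul_bump, mul_one, mul_one]
    refine Ind.bump_mul_bump_of_ne (fun e => hxy ?_) _ _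
    rwa [QuotientGroup.out_eq', QuotientGroup.out_eq'] at e
  mul_ne i j j' k a b h := Mat.diagSum_mul_of_ne _ _ _ _ _ _ fun x y => by
    fin_cases j <;> fin_cases j' <;> simp at h ⊢
  map_smul i j g a := by
    have key : ∀ i (g : G) x,
        (![fun _ => none, some] : Fin 2 → G ⧸ H → Option (G ⧸ H)) i (g • x) =
        g • (![fun _ => none, some] : Fin 2 → G ⧸ H → Option (G ⧸ H)) i x := by
      intro i g x
      fin_cases i <;> rfl
    exact (congrArg (Mat.diagSum _ _) (Ind.coeff_smul (M := A) (N := Ind H A) (Ind.bump 1)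
      Ind.smul_bump_one g a)).trans (Mat.diagSum_permMap (key i) (key j) g _)

/-- All restrictions of a function to cosets are put into the same fixed position, where they add up
to the function itself. -/
theorem indUnits_diag_zero (A : GRing H) : (indUnits H A).diag 0 = entryHom H (ind H A) :=
  RHom.ext_apply fun a => by
    change Ind H A at a
    change Mat.diagSum (fun _ : G ⧸ H => (none : Option (G ⧸ H))) (fun _ => none)
      (Ind.coeff (H := H) (M := A) (N := Ind H A) (Ind.bump 1) a) =
      Mat.single (B := Ind H A) none none a
    refine (Mat.diagSum_eq_sum _ _ _ a.finite.toFinset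
      (Ind.coeff_support_subset _ _)).trans ?_
    rw [← map_sum]
    refine congrArg (Mat.single (B := Ind H A) none none) ?_
    refine Eq.trans (Finset.sum_congr rfl fun x _ => ?_) (Ind.eq_sum a _ subset_rfl)
    rw [Ind.coeff_apply, Ind.smul_bump, mul_one]

/-- The slot of a coset receives the translate to that coset of the bump at `1`, which is the
restriction of the function to the coset; the coefficients on both sides agree by definition. -/
theorem indHom_unitHom_comp_diagHom (A : GRing H) :
    (indHom H (unitHom H A)).comp (diagHom H (ind H A)) = (indUnits H A).diag 1 :=
  RHom.ext_apply fun _ => congrArg (Mat.diagSum (B := Ind H A) some some) (Finsupp.ext fun _ => rfl)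

instance : (indFunctor H).Additive := by unfold indFunctor; infer_instance

instance : (resFunctor H).Additive := by unfold resFunctor; infer_instance

/-- The unit of the adjunction between induction and restriction. -/
def indResUnit : 𝟭 (GK H) ⟶ indFunctor H ⋙ resFunctor H where
  app X := GK.hom (unitHom H X.ring)
  naturality _ _ x := GK.naturality_of_hom (F := 𝟭 (GK H)) (F' := indFunctor H ⋙ resFunctor H)
    (fun A => GK.hom (unitHom H A)) (fun {A B} f => by
      change GK.hom f ≫ GK.hom (unitHom H B) =
        GK.hom (unitHom H A) ≫ GK.hom (resHom H (indHom H f))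
      rw [← GK.hom_comp, ← GK.hom_comp]
      refine congrArg GK.hom (RHom.ext_apply fun a => Eq.symm (Ind.eq_bump ?_ fun k hk => ?_))
      · exact congrArg f (Ind.bump_apply_self (H := H) 1 a)
      · exact (congrArg f (Ind.bump_apply_of_notMem (H := H) a hk)).trans (map_zero f.toHom)) x

/-- The counit of the adjunction between induction and restriction. -/
def indResCounit : resFunctor H ⋙ indFunctor H ⟶ 𝟭 (GK G) where
  app X := counitApp H X.ring
  naturality _ _ x := GK.naturality_of_hom (F := resFunctor H ⋙ indFunctor H) (F' := 𝟭 (GK G))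
    (counitApp H) (counitApp_naturality H) x

/-- Before the inverse of the entry embedding is applied, the composite is the diagonal embedding
spread over the cosets. Rotation turns it into the entry embedding itself, and the two cancel. -/
theorem indHom_unitHom_counitApp (A : GRing H) :
    GK.hom (indHom H (unitHom H A)) ≫ counitApp H (ind H A) = 𝟙 _ := by
  rw [counitApp, ← Category.assoc, ← GK.hom_comp, indHom_unitHom_comp_diagHom,
    ← GK.hom_homotopic (indUnits H A).homotopic_diag, indUnits_diag_zero, IsIso.hom_inv_id]

/-- Before the last inverse the composite embeds `Res B` at the coset `H`; rotating over `H` moves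
it to the fixed point. Functoriality of restriction then cancels the restricted entry embedding
against its restricted inverse, so no stability argument over `H` is required. -/
theorem unitHom_map_counitApp (B : GRing G) :
    GK.hom (unitHom H (res H B)) ≫ (resFunctor H).map (counitApp H B) = 𝟙 _ := by
  have h1 : (resFunctor H).map (GK.hom (entryHom H B)) = GK.hom ((resUnits H B).diag 0) := rfl
  have h2 : (resFunctor H).map (GK.hom (diagHom H B)) = GK.hom (resHom H (diagHom H B)) := rfl
  have h3 : GK.hom (unitHom H (res H B)) ≫ GK.hom (resHom H (diagHom H B)) =
      (resFunctor H).map (GK.hom (entryHom H B)) := by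
    rw [← GK.hom_comp, unitHom_comp_diagHom, h1, GK.hom_homotopic (resUnits H B).homotopic_diag]
  have h4 : (resFunctor H).map (counitApp H B) = (resFunctor H).map (GK.hom (diagHom H B)) ≫
      (resFunctor H).map (inv (GK.hom (entryHom H B))) := Functor.map_comp _ _ _
  refine (congrArg (GK.hom (unitHom H (res H B)) ≫ ·) (h4.trans (congrArg (· ≫ _) h2))).trans ?_
  refine (Category.assoc _ _ _).symm.trans ((congrArg (· ≫ _) h3).trans ?_)
  exact ((resFunctor H).map_comp _ _).symm.trans
    ((congrArg (resFunctor H).map (IsIso.hom_inv_id (GK.hom (entryHom H B)))).trans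
      ((resFunctor H).map_id _))

/-- Induction is left adjoint to restriction. -/
def indResAdjunction : indFunctor H ⊣ resFunctor H where
  unit := indResUnit H
  counit := indResCounit H
  left_triangle_components X := indHom_unitHom_counitApp H X.ring
  right_triangle_components X := unitHom_map_counitApp H X.ring

end Adjunction

end

end GKTheory

theorem mainTheorem6 {G : Type*} [Group G] (H : Subgroup G) :
    ∃ adj : GKTheory.indFunctor H ⊣ GKTheory.resFunctor H,
      ∀ (A : GKTheory.GK H) (B : GKTheory.GK G)
        (x y : (GKTheory.indFunctor H).obj A ⟶ B),
        adj.homEquiv A B (x + y) = adj.homEquiv A B x + adj.homEquiv A B y := by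
  refine ⟨GKTheory.indResAdjunction H, fun A B x y => ?_⟩
  -- The bijection sends `x` to the unit followed by `Res x`, and both restriction and composition
  -- are additive.
  rw [Adjunction.homEquiv_unit, Adjunction.homEquiv_unit, Adjunction.homEquiv_unit,
    Functor.map_add, Preadditive.comp_add]
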